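/- Fix the $k$-player number-on-the-forehead (NOF) model, $k\ge 2$: the input is $(z_1,\dots,z_k)\in(\{0,1\}^n)^k$, player $i$ sees every $z_j$ with $j\ne i$, and players write bits on a public blackboard according to a protocol whose output is $\pm1$ (with $-1$ meaning "true"). For $f:(\{0,1\}^n)^k\to\{-1,1\}$ let $R_k^{\epsilon}(f)$ be the least worst-case number of bits of a public-coin randomized protocol that, on every input, outputs $f$ with probability at least $1/2+\epsilon$ ($R_k^{\epsilon}(f)=\infty$ if there is none). Let $N_k(f)$ be the least cost (length of the proof string plus worst-case number of bits) of a nondeterministic protocol for $f$, that is, one in which all players also see a proof string $y$, such that every input with $f=-1$ yields output $-1$ for some $y$, and every input with $f=1$ yields output $1$ for all $y$. For $k=k(n)$ let $\mathrm{BPP}^{cc}_k$ and $\mathrm{NP}^{cc}_k$ be the classes of families $(f_n)$, $f_n:(\{0,1\}^n)^{k(n)}\to\{-1,1\}$, with $R^{1/3}_{k(n)}(f_n)\le\mathrm{polylog}(n)$ and $N_{k(n)}(f_n)\le\mathrm{polylog}(n)$, respectively. For $x,y^1,\dots,y^{k-1}\in\{0,1\}^n$ let $x\Leftarrow y^1,\dots,y^{k-1}$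 be the string $x_{i_1}\cdots x_{i_t}0^{n-t}$, where $i_1<\dots<i_t$ are the positions at which all of $y^1,\dots,y^{k-1}$ are $1$, and for $g:\{0,1\}^n\to\{-1,1\}$ let $G^g_k(x,y^1,\dots,y^{k-1})=g(x\Leftarrow y^1,\dots,y^{k-1})$. Disjointness is $\mathrm{DISJ}_k=G^{\mathrm{NOR}}_k$ and its negation is $G^{\mathrm{OR}}_k$. **Corollary.** 1. For every $\epsilon>0$ there is a constant $c>0$, depending only on $\epsilon$, such that for all $k\ge 2$ and all $n$ $$R^{\epsilon}_k(\mathrm{DISJ}_k)\;\ge\; c\cdot\frac{n^{\frac1{k+1}}}{2^{2^k}(k-1)2^{k-1}} .$$ 2. In particular, for every $\epsilon>0$ and every fixed $k\ge2$ there is $\alpha>0$ such that $R^{\epsilon}_k(\mathrm{DISJ}_k)\ge n^{\alpha}$ for all sufficiently large $n$. 3. If $k=k(n)\ge2$ and $k=o(\log\log n)$, then the family $G^{\mathrm{OR}}_{k}$ lies in $\mathrm{NP}^{cc}_k$ but not in $\mathrm{BPP}^{cc}_k$. -/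

import Mathlib

open Filter Asymptotics
open scoped ENNReal

namespace NOF

/-- A deterministic number-on-the-forehead protocol for `k` players, player `i` having an element
of `X` on the forehead. The tree branches on the blackboard content: at an inner node player `i`
writes one bit, computed from all inputs except the `i`-th; at a leaf the protocol stops with a
value in `{1, -1}`. The value `-1` stands for "true". -/
inductive Protocol (k : ℕ) (X : Type) : Type
  | output (b : ℤˣ) : Protocol k X
  | speak (i : Fin k) (msg : ({j : Fin k // j ≠ i} → X) → Bool) (next : Bool → Protocol k X) :
      Protocol k X

namespace Protocol

variable {k : ℕ} {X : Type}

/-- The output of the protocol on the input `x`. -/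
def eval : Protocol k X → (Fin k → X) → ℤˣ
  | output b, _ => b
  | speak _ msg next, x => (next (msg fun j => x j)).eval x

/-- The number of bits written on the blackboard on the input `x`. -/
def bits : Protocol k X → (Fin k → X) → ℕ
  | output _, _ => 0
  | speak _ msg next, x => (next (msg fun j => x j)).bits x + 1

end Protocol

/-- There is a public-coin randomized protocol (a probability distribution on deterministic
protocols) which never exchanges more than `c` bits and which, on every input, agrees with `f` with
probability at least `1/2 + ε`. -/
def RandomizedWithin {k : ℕ} {X : Type} (ε : ℝ) (f : (Fin k → X) → ℤˣ) (c : ℕ) : Prop :=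
  ∃ μ : PMF (Protocol k X),
    (∀ P ∈ μ.support, ∀ x, P.bits x ≤ c) ∧
    ∀ x, 1 / 2 + ε ≤ ((μ.map fun P => P.eval x) (f x)).toReal

/-- The randomized `k`-party complexity of `f` with advantage `ε`; it is `⊤` if there is no protocol
with advantage `ε`. -/
noncomputable def R {k : ℕ} {X : Type} (ε : ℝ) (f : (Fin k → X) → ℤˣ) : ℕ∞ :=
  ⨅ (c : ℕ) (_ : RandomizedWithin ε f c), (c : ℕ∞)

/-- There is a nondeterministic protocol for `f` of cost at most `c`: all players see a proof string
`y`, whose length counts towards the cost; inputs with `f x = -1` are accepted for some `y`, inputs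
with `f x = 1` are rejected for all `y`. -/
def NondeterministicWithin {k : ℕ} {X : Type} (f : (Fin k → X) → ℤˣ) (c : ℕ) : Prop :=
  ∃ (l : ℕ) (P : (Fin l → Bool) → Protocol k X),
    (∀ x, f x = -1 → ∃ y, (P y).eval x = -1) ∧
    (∀ x, f x = 1 → ∀ y, (P y).eval x = 1) ∧
    ∀ x y, l + (P y).bits x ≤ c

/-- The nondeterministic `k`-party complexity of `f`. -/
noncomputable def N {k : ℕ} {X : Type} (f : (Fin k → X) → ℤˣ) : ℕ∞ :=
  ⨅ (c : ℕ) (_ : NondeterministicWithin f c), (c : ℕ∞)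

/-- `F n = polylog(n)`. -/
def IsPolylog (F : ℕ → ℕ∞) : Prop :=
  ∃ (a : ℝ) (C : ℕ), ∀ᶠ n : ℕ in atTop, (F n : ℝ≥0∞) ≤ ENNReal.ofReal (a * Real.log n ^ C)

/-- Families of functions, the `n`-th one for `k n` players with `n` input bits each. -/
abbrev Family (k : ℕ → ℕ) : Type :=
  ∀ n : ℕ, (Fin (k n) → (Fin n → Bool)) → ℤˣ

def BPPcc (k : ℕ → ℕ) : Set (Family k) :=
  {f | IsPolylog fun n => R (1 / 3) (f n)}

def NPcc (k : ℕ → ℕ) : Set (Family k) :=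
  {f | IsPolylog fun n => N (f n)}

/-- The masked string `x_{i₁} x_{i₂} … x_{i_t} 0^{n-t}`, where `i₁ < … < i_t` are the all-one columns
of the matrix with rows `y`. -/
def mask {n : ℕ} {ι : Type} [Fintype ι] (x : Fin n → Bool) (y : ι → Fin n → Bool) :
    Fin n → Bool :=
  fun j => (((List.finRange n).filter fun c => ∀ i, y i c = true).map x).getD j false

/-- The `k`-party function `(x, y¹, …, y^{k-1}) ↦ g (x ⇐ y¹, …, y^{k-1})`; the player `0` holds `x`,
the other players hold the `yⁱ`. -/
def G (k : ℕ) [NeZero k] {n : ℕ} (g : (Fin n → Bool) → ℤˣ) (z : Fin k → (Fin n → Bool)) : ℤˣ :=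
  g (mask (z 0) fun i : {i : Fin k // i ≠ 0} => z i)

def OR (n : ℕ) (z : Fin n → Bool) : ℤˣ := if ∃ j, z j = true then -1 else 1

def NOR (n : ℕ) (z : Fin n → Bool) : ℤˣ := if ∃ j, z j = true then 1 else -1

/-- The `k`-party Disjointness function on `n`-bit strings. -/
def DISJ (k : ℕ) [NeZero k] (n : ℕ) : (Fin k → (Fin n → Bool)) → ℤˣ := G k (NOR n)

end NOF

namespace NOF

/-! ### Masked strings -/

/-! The bound is a generalized discrepancy argument. Put `K = k - 1`. Disjointness on `n ≥ m * l ^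
K` coordinates contains a selection problem: `x` consists of `m` blocks, each a `K`-dimensional cube
of side `l`; the other `K` players jointly point to one bit in each block, and NOR is applied to the
`m` selected bits (`DISJ_gadget`).

For `m = A d²`, NOR is hard for polynomials of degree `d`. The witness `ψ` has ℓ¹-norm at most 1, is
orthogonal to every function of at most `d` bits, and has correlation at least `1 - 8/A` with NOR
(`exists_dual_NOR`). It comes from a divided difference at the nodes 0, 1, A, 4A, …, Ad², which has
almost half of its mass at 0.

Weight the inputs `(x, S)` by `2 ^ m * ψ (select x S)` against the uniform measure. Iterated
Cauchy-Schwarz bounds the `2 ^ K`-th power of the correlation with a cylinder function by an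
average, over pairs of choices for each player, of a box product of copies of `ψ`. Call a block bad
if some player's two choices agree there. With at most `d` bad blocks the product averages to zero
(`expect_prod_select_eq_zero`); with `b` bad blocks it is at most `2 ^ (2 ^ K * b)` after
normalization (`abs_expect_prod_select_le`); for large `l`, many bad blocks are exponentially
unlikely (`expect_pow_badBlocks_le`). So the correlation is at most `2 ^ (-d / 2 ^ K)`.

A deterministic `c`-bit protocol is a signed sum of at most `2 ^ c` cylinder functions, and a
randomized protocol with advantage `ε` yields a deterministic one of correlation at least `ε` with
the weight. Hence `d ≤ (c + O_ε(1)) * 2 ^ K` (`RandomizedWithin.degree_le`). Taking `l` proportional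
to `d` makes `n` of order `d ^ (K + 2) = d ^ (k + 1)`, whence the exponent. For `k = o(log log n)`
the bound beats every power of `log n`, while a nondeterministic protocol just guesses a common
column. -/

theorem exists_mask_eq_true {n : ℕ} {ι : Type} [Fintype ι] (x : Fin n → Bool)
    (y : ι → Fin n → Bool) :
    (∃ j, mask x y j = true) ↔ ∃ c, x c = true ∧ ∀ i, y i c = true := by
  set l := ((List.finRange n).filter fun c => ∀ i, y i c = true).map x with hl
  have hlen : l.length ≤ n := by
    rw [hl, List.length_map]
    exact (List.length_filter_le _ _).trans (by simp)
  have hmem : true ∈ l ↔ ∃ c, x c = true ∧ ∀ i, y i c = true := by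
    simp [hl, and_comm]
  rw [← hmem, List.mem_iff_getElem]
  constructor
  · rintro ⟨j, hj⟩
    change l.getD j false = true at hj
    by_cases h : (j : ℕ) < l.length
    · exact ⟨j, h, by rw [List.getD_eq_getElem _ _ h] at hj; exact hj⟩
    · rw [List.getD_eq_default _ _ (not_lt.mp h)] at hj
      cases hj
  · rintro ⟨i, hi, h⟩
    refine ⟨⟨i, hi.trans_le hlen⟩, ?_⟩
    change l.getD i false = true
    rw [List.getD_eq_getElem _ _ hi, h]

open Classical in
theorem DISJ_eq (k : ℕ) [NeZero k] (n : ℕ) (z : Fin k → Fin n → Bool) :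
    DISJ k n z = if ∃ c, ∀ i, z i c = true then 1 else -1 := by
  have h : (∃ j, mask (z 0) (fun i : {i : Fin k // i ≠ 0} => z i) j = true) ↔
      ∃ c, ∀ i, z i c = true := by
    rw [exists_mask_eq_true]
    refine exists_congr fun c => ⟨fun h i => ?_, fun h => ⟨h 0, fun i => h i⟩⟩
    by_cases hi : i = 0
    · exact hi ▸ h.1
    · exact h.2 ⟨i, hi⟩
  simp only [DISJ, G, NOR, h]

theorem G_OR_eq_neg_DISJ (k : ℕ) [NeZero k] (n : ℕ) (z : Fin k → Fin n → Bool) :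
    G k (OR n) z = -DISJ k n z := by
  simp only [DISJ, G, OR, NOR]
  split_ifs <;> simp

/-! ### Negating the output of a protocol -/

namespace Protocol

variable {k : ℕ} {X : Type}

/-- The protocol with the opposite output. -/
def neg : Protocol k X → Protocol k X
  | output b => output (-b)
  | speak i msg next => speak i msg fun b => (next b).neg

theorem eval_neg (P : Protocol k X) (x : Fin k → X) : P.neg.eval x = -P.eval x := by
  induction P with
  | output b => rfl
  | speak i msg next ih => exact ih _

theorem bits_neg (P : Protocol k X) (x : Fin k → X) : P.neg.bits x = P.bits x := by
  induction P with
  | output b => rfl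
  | speak i msg next ih => exact congrArg (· + 1) (ih _)

end Protocol

theorem RandomizedWithin.neg {k : ℕ} {X : Type} {ε : ℝ} {f : (Fin k → X) → ℤˣ} {c : ℕ}
    (h : RandomizedWithin ε f c) : RandomizedWithin ε (fun x => -f x) c := by
  obtain ⟨μ, hμ, hf⟩ := h
  refine ⟨μ.map Protocol.neg, fun P hP x => ?_, fun x => ?_⟩
  · rw [PMF.mem_support_map_iff] at hP
    obtain ⟨Q, hQ, rfl⟩ := hP
    rw [Protocol.bits_neg]
    exact hμ Q hQ x
  · rw [PMF.map_comp]
    have h1 : (fun P : Protocol k X => P.eval x) ∘ Protocol.neg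
        = (fun b : ℤˣ => -b) ∘ fun P => P.eval x := by
      funext P
      exact P.eval_neg x
    rw [h1]
    refine (hf x).trans (le_of_eq (congrArg _ ?_))
    simp only [PMF.map_apply, Function.comp_apply, neg_inj]
    exact tsum_congr fun _ => by congr

theorem R_neg_le {k : ℕ} {X : Type} (ε : ℝ) (f : (Fin k → X) → ℤˣ) :
    R ε (fun x => -f x) ≤ R ε f :=
  le_iInf₂ fun c hc => iInf₂_le c hc.neg

/-- A finite infimum of natural numbers is attained, so lower bounds on `R` reduce to bounds on the
cost of each single protocol; the value `⊤` is harmless. -/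
theorem le_R_iff {k : ℕ} {X : Type} {ε : ℝ} {f : (Fin k → X) → ℤˣ} {a : ℝ} :
    ENNReal.ofReal a ≤ (R ε f : ℝ≥0∞) ↔ ∀ c : ℕ, RandomizedWithin ε f c → a ≤ c := by
  constructor
  · intro h c hc
    have h1 : (R ε f : ℝ≥0∞) ≤ ((c : ℕ∞) : ℝ≥0∞) := by
      exact_mod_cast iInf₂_le (α := ℕ∞) c hc
    have h2 := h.trans h1
    rw [ENat.toENNReal_coe, ← ENNReal.ofReal_natCast,
      ENNReal.ofReal_le_ofReal_iff (Nat.cast_nonneg c)] at h2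
    exact h2
  · intro h
    by_cases htop : R ε f = ⊤
    · simp [htop]
    · obtain ⟨r, hr⟩ := ENat.ne_top_iff_exists.mp htop
      have hle : ∃ c : ℕ, RandomizedWithin ε f c ∧ (c : ℕ∞) ≤ r := by
        by_contra! hcon
        have : ((r + 1 : ℕ) : ℕ∞) ≤ R ε f := by
          refine le_iInf₂ fun c hc => ?_
          have := hcon c hc
          exact_mod_cast this
        rw [← hr] at this
        norm_cast at this
        omega
      obtain ⟨c, hc, hcr⟩ := hle
      rw [← hr, ENat.toENNReal_coe, ← ENNReal.ofReal_natCast]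
      refine ENNReal.ofReal_le_ofReal ((h c hc).trans ?_)
      exact_mod_cast hcr

/-! ### Nondeterministic upper bound -/

/-- A protocol that checks whether column `c` is an all-one column. -/
def checkColumn (k : ℕ) [NeZero k] (hk : 2 ≤ k) (n : ℕ) (c : Fin n) : Protocol k (Fin n → Bool) :=
  .speak 0 (fun z => decide (∀ j, z j c = true)) fun b =>
    if b then
      -- Player 0 cannot see row 0, so a second player has to report its entry.
      .speak ⟨1, hk⟩ (fun z => z ⟨0, fun h => by simpa using congrArg Fin.val h⟩ c) fun b' =>
        if b' then .output (-1) else .output 1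
    else .output 1

theorem checkColumn_eval (k : ℕ) [NeZero k] (hk : 2 ≤ k) (n : ℕ) (c : Fin n)
    (z : Fin k → Fin n → Bool) :
    (checkColumn k hk n c).eval z = -1 ↔ ∀ i, z i c = true := by
  by_cases h : ∀ j : {j : Fin k // j ≠ 0}, z j c = true
  · have h' : (∀ i, z i c = true) ↔ z 0 c = true := by
      refine ⟨fun h => h 0, fun h0 i => ?_⟩
      by_cases hi : i = 0
      · exact hi ▸ h0
      · exact h ⟨i, hi⟩
    rw [h']
    cases h0 : z 0 c <;> simp only [checkColumn, Protocol.eval, h] <;> simp [Protocol.eval, h0]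
  · have h' : ¬ ∀ i, z i c = true := fun hh => h fun j => hh j
    simp only [h', iff_false]
    simp only [checkColumn, Protocol.eval, h]
    simp [Protocol.eval]

theorem checkColumn_bits (k : ℕ) [NeZero k] (hk : 2 ≤ k) (n : ℕ) (c : Fin n)
    (z : Fin k → Fin n → Bool) :
    (checkColumn k hk n c).bits z ≤ 2 := by
  simp only [checkColumn, Protocol.bits]
  split_ifs
  · simp only [Protocol.bits]
    split_ifs <;> simp [Protocol.bits]
  · simp [Protocol.bits]

theorem units_int_eq_one_of_ne {u : ℤˣ} (h : u ≠ -1) : u = 1 :=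
  (Int.units_eq_one_or u).resolve_right h

theorem nondeterministicWithin_OR (k : ℕ) [NeZero k] (hk : 2 ≤ k) (n : ℕ) :
    NondeterministicWithin (G k (OR n)) (Nat.clog 2 n + 2) := by
  classical
  obtain ⟨σ⟩ : Nonempty (Fin n ↪ (Fin (Nat.clog 2 n) → Bool)) := by
    rw [Function.Embedding.nonempty_iff_card_le]
    simpa using Nat.le_pow_clog one_lt_two n
  -- The proof string is the code of a common column; strings that code no column are rejected.
  refine ⟨Nat.clog 2 n, fun y => if h : ∃ c, σ c = y then checkColumn k hk n h.choose
    else .output 1, fun x hx => ?_, fun x hx y => ?_, fun x y => ?_⟩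
  · rw [G_OR_eq_neg_DISJ, DISJ_eq] at hx
    split_ifs at hx with h
    · obtain ⟨c, hc⟩ := h
      refine ⟨σ c, ?_⟩
      have hex : ∃ c', σ c' = σ c := ⟨c, rfl⟩
      dsimp only
      rw [dif_pos hex, checkColumn_eval, σ.injective hex.choose_spec]
      exact hc
    · simp at hx
  · rw [G_OR_eq_neg_DISJ, DISJ_eq] at hx
    split_ifs at hx with h
    · simp at hx
    · dsimp only
      split_ifs with hy
      · refine units_int_eq_one_of_ne fun hh => h ?_
        rw [checkColumn_eval] at hh
        exact ⟨_, hh⟩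
      · rfl
  · refine Nat.add_le_add_left ?_ _
    dsimp only
    split_ifs
    · exact checkColumn_bits k hk n _ x
    · exact Nat.zero_le _

theorem N_OR_le (k : ℕ) [NeZero k] (hk : 2 ≤ k) (n : ℕ) :
    N (G k (OR n)) ≤ ((Nat.clog 2 n + 2 : ℕ) : ℕ∞) :=
  iInf₂_le _ (nondeterministicWithin_OR k hk n)

/-! ### Cylinder functions and protocols -/

/-- A product of functions bounded by one, the `i`-th of which ignores the `i`-th input. -/
def IsCylinder {k : ℕ} {X : Type} (φ : (Fin k → X) → ℝ) : Prop :=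
  ∃ F : Fin k → (Fin k → X) → ℝ, (∀ i z, |F i z| ≤ 1) ∧
    (∀ i z a, F i (Function.update z i a) = F i z) ∧ ∀ z, φ z = ∏ i, F i z

theorem isCylinder_one {k : ℕ} {X : Type} : IsCylinder (fun _ : Fin k → X => (1 : ℝ)) :=
  ⟨fun _ _ => 1, by simp, by simp, by simp⟩

/-- A message of player `i` ignores the `i`-th input, so its indicator can be absorbed into the
`i`-th factor. -/
theorem IsCylinder.mul_indicator {k : ℕ} {X : Type} {φ : (Fin k → X) → ℝ} (hφ : IsCylinder φ)
    (i : Fin k) (msg : ({j : Fin k // j ≠ i} → X) → Bool) (b : Bool) :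
    IsCylinder fun z => φ z * if msg (fun j => z j) = b then 1 else 0 := by
  obtain ⟨F, h1, h2, h3⟩ := hφ
  refine ⟨fun i' z => F i' z * if i' = i then (if msg (fun j => z j) = b then 1 else 0) else 1,
    fun i' z => ?_, fun i' z a => ?_, fun z => ?_⟩
  · rw [abs_mul]
    refine mul_le_one₀ (h1 i' z) (abs_nonneg _) ?_
    split_ifs <;> simp
  · dsimp only
    rw [h2]
    by_cases hi : i' = i
    · subst hi
      have : (fun j : {j : Fin k // j ≠ i'} => Function.update z i' a j) =
          fun j : {j : Fin k // j ≠ i'} => z j := by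
        funext j
        exact Function.update_of_ne j.2 _ _
      rw [this]
    · simp [hi]
  · rw [Finset.prod_mul_distrib, ← h3]
    simp

/-- Here `φ` is the indicator of the history that leads to the current node. Each bit splits it into
two cylinder functions, so the bound doubles per bit. The cost needs control only where `φ` does not
vanish, which is what the induction preserves. -/
theorem Protocol.abs_sum_mul_eval_le {k : ℕ} {X W : Type} [Fintype W] (Ψ : W → ℝ)
    (e : W → Fin k → X) {D : ℝ} (hD : ∀ φ, IsCylinder φ → |∑ w, Ψ w * φ (e w)| ≤ D)
    (P : Protocol k X) (c : ℕ) (φ : (Fin k → X) → ℝ) (hφ : IsCylinder φ)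
    (hc : ∀ z, φ z ≠ 0 → P.bits z ≤ c) :
    |∑ w, Ψ w * (φ (e w) * ((P.eval (e w) : ℤ) : ℝ))| ≤ 2 ^ c * D := by
  have hD0 : 0 ≤ D := (abs_nonneg _).trans (hD _ isCylinder_one)
  induction P generalizing c φ with
  | output b =>
    have h1 : ∑ w, Ψ w * (φ (e w) * ((b : ℤ) : ℝ)) = (∑ w, Ψ w * φ (e w)) * ((b : ℤ) : ℝ) := by
      rw [Finset.sum_mul]
      exact Finset.sum_congr rfl fun _ _ => by ring
    have h2 : |((b : ℤ) : ℝ)| = 1 := by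
      rcases Int.units_eq_one_or b with rfl | rfl <;> simp
    simp only [Protocol.eval]
    rw [h1, abs_mul, h2, mul_one]
    exact (hD φ hφ).trans (le_mul_of_one_le_left hD0 (one_le_pow₀ one_le_two))
  | speak i msg next ih =>
    cases c with
    | zero =>
      have h0 : ∀ z, φ z = 0 := fun z => by
        by_contra hz
        have := hc z hz
        simp [Protocol.bits] at this
      simp [h0, hD0]
    | succ c =>
      have key : ∀ b, |∑ w, Ψ w * ((φ (e w) * if msg (fun j => e w j) = b then 1 else 0) *
          (((next b).eval (e w) : ℤ) : ℝ))| ≤ 2 ^ c * D := fun b => by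
        refine ih b c _ (hφ.mul_indicator i msg b) fun z hz => ?_
        have hm : msg (fun j => z j) = b := by
          by_contra hm
          simp [hm] at hz
        have := hc z (left_ne_zero_of_mul hz)
        simp only [Protocol.bits, hm] at this
        omega
      have hsplit : ∑ w, Ψ w * (φ (e w) * (((speak i msg next).eval (e w) : ℤ) : ℝ)) =
          (∑ w, Ψ w * ((φ (e w) * if msg (fun j => e w j) = true then 1 else 0) *
            (((next true).eval (e w) : ℤ) : ℝ))) +
          ∑ w, Ψ w * ((φ (e w) * if msg (fun j => e w j) = false then 1 else 0) *
            (((next false).eval (e w) : ℤ) : ℝ)) := by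
        rw [← Finset.sum_add_distrib]
        refine Finset.sum_congr rfl fun w _ => ?_
        cases hm : msg (fun j => e w j) <;> simp [Protocol.eval, hm]
      rw [hsplit, pow_succ]
      refine (abs_add_le _ _).trans ?_
      linarith [key true, key false]

end NOF

namespace NOF

open scoped BigOperators

/-! ### Averages over finite types -/

theorem expect_prod_type {α β : Type*} [Fintype α] [Fintype β] (f : α × β → ℝ) :
    𝔼 p, f p = 𝔼 a, 𝔼 b, f (a, b) := by
  rw [← Finset.univ_product_univ, Finset.expect_product]

theorem expect_univ_equiv {α β : Type*} [Fintype α] [Fintype β] (e : α ≃ β) (f : β → ℝ) :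
    𝔼 a, f (e a) = 𝔼 b, f b :=
  Finset.expect_equiv e (by simp) (by simp)

theorem expect_fin_cons {K : ℕ} {Y : Type*} [Fintype Y] (f : (Fin (K + 1) → Y) → ℝ) :
    𝔼 S, f S = 𝔼 y, 𝔼 S : Fin K → Y, f (Fin.cons y S) := by
  rw [← expect_prod_type fun p : Y × (Fin K → Y) => f (Fin.cons p.1 p.2)]
  exact (expect_univ_equiv (Fin.consEquiv fun _ : Fin (K + 1) => Y) f).symm

theorem abs_expect_pow_le {α : Type*} [Fintype α] [Nonempty α] (f : α → ℝ) (n : ℕ) :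
    |𝔼 a, f a| ^ n ≤ 𝔼 a, |f a| ^ n := by
  have hc : (0 : ℝ) < Fintype.card α := by exact_mod_cast Fintype.card_pos
  refine (pow_le_pow_left₀ (abs_nonneg _) (Finset.abs_expect_le _ _) n).trans ?_
  have := Real.pow_arith_mean_le_arith_mean_pow Finset.univ
    (fun _ : α => (Fintype.card α : ℝ)⁻¹) (fun a => |f a|) (fun _ _ => by positivity)
    (by simp [hc.ne']) (fun _ _ => abs_nonneg _) n
  simpa only [Fintype.expect_eq_sum_div_card, div_eq_inv_mul, Finset.mul_sum] using this

/-- The average of a function of two independent copies. -/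
theorem expect_bool_arrow {Y : Type*} [Fintype Y] (f : (Bool → Y) → ℝ) :
    𝔼 s, f s = 𝔼 y, 𝔼 y', f (fun b => cond b y' y) := by
  rw [← expect_prod_type fun p : Y × Y => f (fun b => cond b p.2 p.1),
    ← expect_univ_equiv (Equiv.boolArrowEquivProd Y)]
  refine Finset.expect_congr rfl fun s _ => congrArg f ?_
  funext b
  cases b <;> rfl

/-! ### Iterated Cauchy-Schwarz inequality -/

/-- The correlation of `ψ` with a product of functions, one ignoring `x` and the others ignoring
one of the remaining arguments each, is bounded by a box norm of `ψ`. -/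
theorem abs_expect_mul_cylinder_pow_le {X Y : Type*} [Fintype X] [Nonempty X] [Fintype Y]
    [Nonempty Y] (K : ℕ) (ψ : X → (Fin K → Y) → ℝ) (φ₀ : (Fin K → Y) → ℝ)
    (φ : Fin K → X → (Fin K → Y) → ℝ) (h₀ : ∀ S, |φ₀ S| ≤ 1) (h : ∀ i x S, |φ i x S| ≤ 1)
    (hφ : ∀ i x S y, φ i x (Function.update S i y) = φ i x S) :
    |𝔼 x, 𝔼 S, ψ x S * (φ₀ S * ∏ i, φ i x S)| ^ 2 ^ K ≤
      𝔼 S : Fin K → Bool → Y, |𝔼 x, ∏ u : Fin K → Bool, ψ x fun i => S i (u i)| := by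
  induction K with
  | zero =>
    -- With no choices left, `φ₀` is a constant and leaves the average over `x`.
    simp only [Finset.univ_eq_empty, Finset.prod_empty, mul_one, pow_zero, pow_one,
      Finset.univ_unique, Finset.prod_singleton, Finset.expect_singleton]
    rw [← Finset.expect_mul, abs_mul]
    refine (mul_le_of_le_one_right (abs_nonneg _) (h₀ _)).trans (le_of_eq ?_)
    congr 1
    exact Finset.expect_congr rfl fun x _ => congrArg _ (Subsingleton.elim _ _)
  | succ K ih =>
    let y₀ : Y := Classical.arbitrary Y
    have hφ0 : ∀ x y (S : Fin K → Y), φ 0 x (Fin.cons y S) = φ 0 x (Fin.cons y₀ S) := by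
      intro x y S
      rw [← Fin.update_cons_zero (α := fun _ => Y) y₀ S y, hφ]
    let g : X → (Fin K → Y) → Y → ℝ := fun x S y =>
      ψ x (Fin.cons y S) * (φ₀ (Fin.cons y S) * ∏ i : Fin K, φ i.succ x (Fin.cons y S))
    let B : Y → Y → ℝ := fun y y' => 𝔼 x, 𝔼 S : Fin K → Y, g x S y * g x S y'
    -- `φ 0` does not see the coordinate `y = S 0`, so it comes out of the average over `y`.
    have h1 : 𝔼 x, 𝔼 S, ψ x S * (φ₀ S * ∏ i, φ i x S) =
        𝔼 x, 𝔼 S : Fin K → Y, φ 0 x (Fin.cons y₀ S) * 𝔼 y, g x S y := by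
      refine Finset.expect_congr rfl fun x _ => ?_
      rw [expect_fin_cons, Finset.expect_comm]
      refine Finset.expect_congr rfl fun S _ => ?_
      rw [Finset.mul_expect]
      refine Finset.expect_congr rfl fun y _ => ?_
      rw [Fin.prod_univ_succ, hφ0]
      ring
    -- Cauchy-Schwarz discards `φ 0` and doubles `y` into an independent pair.
    have h2 : |𝔼 x, 𝔼 S, ψ x S * (φ₀ S * ∏ i, φ i x S)| ^ 2 ≤ 𝔼 y, 𝔼 y', B y y' := by
      rw [h1]
      refine (abs_expect_pow_le _ 2).trans ?_
      have h3 : 𝔼 y, 𝔼 y', B y y' = 𝔼 x, 𝔼 S : Fin K → Y, (𝔼 y, g x S y) ^ 2 := by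
        calc 𝔼 y, 𝔼 y', B y y'
            = 𝔼 y, 𝔼 x, 𝔼 y', 𝔼 S : Fin K → Y, g x S y * g x S y' :=
              Finset.expect_congr rfl fun y _ => Finset.expect_comm _ _ _
          _ = 𝔼 x, 𝔼 y, 𝔼 y', 𝔼 S : Fin K → Y, g x S y * g x S y' := Finset.expect_comm _ _ _
          _ = 𝔼 x, 𝔼 S : Fin K → Y, (𝔼 y, g x S y) ^ 2 := by
            refine Finset.expect_congr rfl fun x _ => ?_
            calc 𝔼 y, 𝔼 y', 𝔼 S : Fin K → Y, g x S y * g x S y'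
                = 𝔼 y, 𝔼 S : Fin K → Y, 𝔼 y', g x S y * g x S y' :=
                  Finset.expect_congr rfl fun y _ => Finset.expect_comm _ _ _
              _ = 𝔼 S : Fin K → Y, 𝔼 y, 𝔼 y', g x S y * g x S y' := Finset.expect_comm _ _ _
              _ = _ := Finset.expect_congr rfl fun S _ => by
                rw [sq, Finset.expect_mul_expect]
      rw [h3]
      refine Finset.expect_le_expect fun x _ => (abs_expect_pow_le _ 2).trans ?_
      refine Finset.expect_le_expect fun S _ => ?_
      rw [abs_mul, mul_pow, sq_abs (𝔼 y, g x S y)]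
      exact mul_le_of_le_one_left (sq_nonneg _) (pow_le_one₀ (abs_nonneg _) (h _ _ _))
    -- For fixed `y, y'` the products of two copies again have the required form, with one argument
    -- fewer.
    have h4 : ∀ y y', |B y y'| ^ 2 ^ K ≤ 𝔼 S : Fin K → Bool → Y, |𝔼 x, ∏ u : Fin K → Bool,
        (ψ x (Fin.cons y fun i => S i (u i)) * ψ x (Fin.cons y' fun i => S i (u i)))| := by
      intro y y'
      have := ih (fun x S => ψ x (Fin.cons y S) * ψ x (Fin.cons y' S))
        (fun S => φ₀ (Fin.cons y S) * φ₀ (Fin.cons y' S))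
        (fun i x S => φ i.succ x (Fin.cons y S) * φ i.succ x (Fin.cons y' S))
        (fun S => by
          rw [abs_mul]
          exact mul_le_one₀ (h₀ _) (abs_nonneg _) (h₀ _))
        (fun i x S => by
          rw [abs_mul]
          exact mul_le_one₀ (h _ _ _) (abs_nonneg _) (h _ _ _))
        (fun i x S a => by rw [Fin.cons_update, Fin.cons_update, hφ, hφ])
      refine le_trans (le_of_eq ?_) this
      congr 2
      refine Finset.expect_congr rfl fun x _ => Finset.expect_congr rfl fun S _ => ?_
      simp only [g, Finset.prod_mul_distrib]
      ring
    calc |𝔼 x, 𝔼 S, ψ x S * (φ₀ S * ∏ i, φ i x S)| ^ 2 ^ (K + 1)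
        = (|𝔼 x, 𝔼 S, ψ x S * (φ₀ S * ∏ i, φ i x S)| ^ 2) ^ 2 ^ K := by
          rw [← pow_mul, pow_succ, mul_comm]
      _ ≤ |𝔼 y, 𝔼 y', B y y'| ^ 2 ^ K :=
          pow_le_pow_left₀ (sq_nonneg _) (h2.trans (le_abs_self _)) _
      _ ≤ 𝔼 y, 𝔼 y', |B y y'| ^ 2 ^ K := (abs_expect_pow_le _ _).trans
          (Finset.expect_le_expect fun y _ => abs_expect_pow_le _ _)
      _ ≤ 𝔼 y, 𝔼 y', 𝔼 S : Fin K → Bool → Y, |𝔼 x, ∏ u : Fin K → Bool,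
          (ψ x (Fin.cons y fun i => S i (u i)) * ψ x (Fin.cons y' fun i => S i (u i)))| :=
          Finset.expect_le_expect fun y _ => Finset.expect_le_expect fun y' _ => h4 y y'
      _ = _ := by
          rw [expect_fin_cons, expect_bool_arrow]
          refine Finset.expect_congr rfl fun y _ => Finset.expect_congr rfl fun y' _ =>
            Finset.expect_congr rfl fun S _ => ?_
          congr 1
          refine Finset.expect_congr rfl fun x _ => ?_
          rw [← (Fin.consEquiv fun _ : Fin (K + 1) => Bool).prod_comp, Fintype.prod_prod_type,
            Fintype.prod_bool, ← Finset.prod_mul_distrib]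
          refine Finset.prod_congr rfl fun u _ => ?_
          rw [mul_comm]
          congr 2 <;>
          · funext i
            refine Fin.cases ?_ (fun i => ?_) i <;> simp [Fin.consEquiv]

end NOF

namespace NOF

open scoped BigOperators Nat

/-! ### Divided differences at squares -/

theorem prod_erase_eq_prod_ite {ι : Type*} [DecidableEq ι] (s : Finset ι) (i : ι) (f : ι → ℝ) :
    ∏ j ∈ s.erase i, f j = ∏ j ∈ s, if j = i then 1 else f j := by
  rw [← Finset.prod_erase s (a := i) (by simp)]
  exact Finset.prod_congr rfl fun j hj => by simp [(Finset.mem_erase.mp hj).1]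

/-- Each factor splits as `(i - j) * (i + j + 2)`, and both resulting products are quotients of
factorials. -/
theorem prod_range_succ_sq_sub (i : ℕ) :
    ((i + 1)! : ℝ) * ∏ j ∈ Finset.range i, (((i : ℝ) + 1) ^ 2 - ((j : ℝ) + 1) ^ 2) =
      i ! * (2 * i + 1)! := by
  have h1 : ∏ j ∈ Finset.range i, ((i : ℝ) - j) = i ! := by
    rw [← Finset.prod_range_add_one_eq_factorial, Nat.cast_prod, ← Finset.prod_range_reflect]
    refine Finset.prod_congr rfl fun j hj => ?_
    have := Finset.mem_range.mp hj
    rw [show i - 1 - j = i - (1 + j) by omega, Nat.cast_sub (by omega)]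
    push_cast
    ring
  have h2 : ((i + 1)! : ℝ) * ∏ j ∈ Finset.range i, ((i : ℝ) + 2 + j) = (2 * i + 1)! := by
    have := Nat.factorial_mul_ascFactorial (i + 1) i
    rw [Nat.ascFactorial_eq_prod_range] at this
    rw [show 2 * i + 1 = i + 1 + i by ring, ← this]
    push_cast
    congr 1
    exact Finset.prod_congr rfl fun j _ => by ring
  rw [← h2, ← h1, mul_left_comm, ← Finset.prod_mul_distrib]
  congr 1
  exact Finset.prod_congr rfl fun j _ => by ring

/-- With `a = i + 1` this is the classical `∏_{j ≠ a} j² / |a² - j²| = 2 d!² / ((d - a)! (d + a)!)`,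
cleared of denominators. -/
theorem prod_sq_mul_factorial (i d : ℕ) (hid : i + 1 ≤ d) :
    (∏ j ∈ Finset.range d, if j = i then (1 : ℝ) else ((j : ℝ) + 1) ^ 2) *
        ((d - (i + 1))! * (d + (i + 1))!) =
      2 * (d ! : ℝ) ^ 2 * ∏ j ∈ Finset.range d,
        if j = i then (1 : ℝ) else |((i : ℝ) + 1) ^ 2 - ((j : ℝ) + 1) ^ 2| := by
  induction d, hid using Nat.le_induction with
  | base =>
    have h1 : ∏ j ∈ Finset.range i, (if j = i then (1 : ℝ) else ((j : ℝ) + 1) ^ 2) =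
        (i ! : ℝ) ^ 2 := by
      rw [← Finset.prod_range_add_one_eq_factorial, Nat.cast_prod, ← Finset.prod_pow]
      refine Finset.prod_congr rfl fun j hj => ?_
      rw [if_neg (Finset.mem_range.mp hj).ne]
      push_cast
      rfl
    have h2 : ∏ j ∈ Finset.range i,
          (if j = i then (1 : ℝ) else |((i : ℝ) + 1) ^ 2 - ((j : ℝ) + 1) ^ 2|) =
        ∏ j ∈ Finset.range i, (((i : ℝ) + 1) ^ 2 - ((j : ℝ) + 1) ^ 2) := by
      refine Finset.prod_congr rfl fun j hj => ?_
      have hj' := Finset.mem_range.mp hj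
      rw [if_neg hj'.ne, abs_of_nonneg]
      have : (j : ℝ) ≤ i := by exact_mod_cast hj'.le
      have hj0 : (0 : ℝ) ≤ j := Nat.cast_nonneg j
      nlinarith
    have h3 := prod_range_succ_sq_sub i
    have h4 : (((i + 1) + (i + 1))! : ℝ) = (2 * i + 2) * (2 * i + 1)! := by
      rw [show (i + 1) + (i + 1) = (2 * i + 1) + 1 by ring, Nat.factorial_succ (2 * i + 1)]
      push_cast
      ring
    rw [Finset.prod_range_succ, Finset.prod_range_succ, h1, h2, h4]
    simp only [if_true, mul_one, Nat.sub_self, Nat.factorial_zero, Nat.cast_one, one_mul]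
    have h5 : ((i + 1)! : ℝ) = (i + 1) * i ! := by
      rw [Nat.factorial_succ]
      push_cast
      ring
    calc (i ! : ℝ) ^ 2 * ((2 * i + 2) * (2 * i + 1)!)
        = 2 * (i + 1) * i ! * (i ! * (2 * i + 1)!) := by ring
      _ = 2 * (i + 1) * i ! * ((i + 1)! * _) := by rw [h3]
      _ = _ := by rw [h5]; ring
  | succ d hid ih =>
    have hne : d ≠ i := by omega
    rw [Finset.prod_range_succ, Finset.prod_range_succ, if_neg hne, if_neg hne,
      show d + 1 - (i + 1) = (d - (i + 1)) + 1 by omega,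
      show d + 1 + (i + 1) = (d + (i + 1)) + 1 by ring, Nat.factorial_succ (d - (i + 1)),
      Nat.factorial_succ (d + (i + 1)), Nat.factorial_succ d]
    have hle : (i : ℝ) + 1 ≤ d := by exact_mod_cast hid
    have habs : |((i : ℝ) + 1) ^ 2 - ((d : ℝ) + 1) ^ 2| = ((d : ℝ) - i) * (d + i + 2) := by
      have hi0 : (0 : ℝ) ≤ i := Nat.cast_nonneg i
      rw [abs_of_nonpos (by nlinarith)]
      ring
    rw [habs]
    push_cast [Nat.cast_sub hid]
    linear_combination (((d : ℝ) + 1) ^ 2 * ((d : ℝ) - i) * (d + i + 2)) * ih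

/-- `d! / (d - a)!` has `a` factors that are at most `d`, and `(d + a)! / d!` has `a` factors above
`d`. -/
theorem factorial_sq_le (a d : ℕ) (h : a ≤ d) : d ! ^ 2 ≤ (d - a)! * (d + a)! := by
  have h1 := Nat.factorial_mul_descFactorial h
  have h2 := Nat.descFactorial_le_pow d a
  have h3 : d ! * (d + 1) ^ a ≤ (d + a)! := Nat.factorial_mul_pow_le_factorial
  calc d ! ^ 2 = ((d - a)! * d.descFactorial a) * d ! := by rw [h1, sq]
    _ ≤ ((d - a)! * (d + 1) ^ a) * d ! := by
        gcongr
        exact h2.trans (Nat.pow_le_pow_left (Nat.le_succ d) a)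
    _ = (d - a)! * (d ! * (d + 1) ^ a) := by ring
    _ ≤ _ := by gcongr

theorem prod_sq_le_two_mul (i d : ℕ) (hid : i + 1 ≤ d) :
    (∏ j ∈ Finset.range d, if j = i then (1 : ℝ) else ((j : ℝ) + 1) ^ 2) ≤
      2 * ∏ j ∈ Finset.range d,
        if j = i then (1 : ℝ) else |((i : ℝ) + 1) ^ 2 - ((j : ℝ) + 1) ^ 2| := by
  have h1 := prod_sq_mul_factorial i d hid
  have h2 : (d ! : ℝ) ^ 2 ≤ (d - (i + 1))! * (d + (i + 1))! := by
    exact_mod_cast factorial_sq_le (i + 1) d hid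
  have hp : (0 : ℝ) < (d - (i + 1))! * (d + (i + 1))! := by positivity
  have h0 : 0 ≤ ∏ j ∈ Finset.range d,
      if j = i then (1 : ℝ) else |((i : ℝ) + 1) ^ 2 - ((j : ℝ) + 1) ^ 2| :=
    Finset.prod_nonneg fun j _ => by split_ifs <;> positivity
  refine le_of_mul_le_mul_right (h1.le.trans ?_) hp
  calc _ = (2 * ∏ j ∈ Finset.range d,
        if j = i then (1 : ℝ) else |((i : ℝ) + 1) ^ 2 - ((j : ℝ) + 1) ^ 2|) * (d ! : ℝ) ^ 2 := by
          ring
    _ ≤ _ := by gcongr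

theorem sum_inv_sq_le (d : ℕ) : ∑ i ∈ Finset.range d, (((i : ℝ) + 1) ^ 2)⁻¹ ≤ 2 := by
  have h := sum_Ioo_inv_sq_le (α := ℝ) 0 (d + 1)
  refine le_trans (le_of_eq ?_) (h.trans (by norm_num))
  refine Finset.sum_bij (fun i _ => i + 1) (fun i hi => ?_) (fun _ _ _ _ => by simp)
    (fun b hb => ?_) (fun i _ => by push_cast; rfl)
  · have := Finset.mem_range.mp hi
    simp only [Finset.mem_Ioo]
    omega
  · have := Finset.mem_Ioo.mp hb
    exact ⟨b - 1, Finset.mem_range.mpr (by omega), by omega⟩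

/-! ### A dual polynomial for `OR` -/

/-- The nodes `0, 1, A, 4A, 9A, …`. -/
def node (A : ℕ) : ℕ → ℕ
  | 0 => 0
  | 1 => 1
  | i + 2 => A * (i + 1) ^ 2

theorem node_strictMono {A : ℕ} (hA : 2 ≤ A) : StrictMono (node A) := by
  refine strictMono_nat_of_lt_succ fun i => ?_
  match i with
  | 0 => simp [node]
  | 1 => simp only [node]; omega
  | i + 2 =>
    simp only [node]
    have : (i + 1) ^ 2 < (i + 1 + 1) ^ 2 := Nat.pow_lt_pow_left (by omega) (by omega)
    exact Nat.mul_lt_mul_of_pos_left this (by omega)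

/-- The product of the distances of the `i`-th node from the other ones. -/
noncomputable def nodeDist (A d i : ℕ) : ℝ :=
  ∏ j ∈ (Finset.range (d + 2)).erase i, ((node A i : ℝ) - node A j)

theorem nodeDist_ne_zero {A : ℕ} (hA : 2 ≤ A) (d i : ℕ) : nodeDist A d i ≠ 0 := by
  refine Finset.prod_ne_zero_iff.mpr fun j hj => sub_ne_zero.mpr fun h => ?_
  exact (Finset.mem_erase.mp hj).1 ((node_strictMono hA).injective (Nat.cast_injective h)).symm

theorem abs_nodeDist (A d i : ℕ) : |nodeDist A d i| =
    (∏ j ∈ Finset.range d, if j + 2 = i then 1 else |(node A i : ℝ) - A * ((j : ℝ) + 1) ^ 2|) *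
      (if 1 = i then 1 else |(node A i : ℝ) - 1|) * (if 0 = i then 1 else |(node A i : ℝ)|) := by
  rw [nodeDist, prod_erase_eq_prod_ite, Finset.abs_prod, Finset.prod_range_succ',
    Finset.prod_range_succ']
  simp only [apply_ite abs, abs_one, node]
  push_cast
  simp

theorem abs_nodeDist_zero (A d : ℕ) :
    |nodeDist A d 0| = ∏ j ∈ Finset.range d, (A * ((j : ℝ) + 1) ^ 2) := by
  rw [abs_nodeDist]
  simp only [node]
  simp

theorem abs_nodeDist_one {A : ℕ} (hA : 2 ≤ A) (d : ℕ) :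
    |nodeDist A d 1| = ∏ j ∈ Finset.range d, (A * ((j : ℝ) + 1) ^ 2 - 1) := by
  rw [abs_nodeDist]
  simp only [node]
  simp only [Nat.reduceEqDiff, Nat.cast_one, if_true, mul_one, zero_ne_one, if_false, abs_one]
  refine Finset.prod_congr rfl fun j _ => ?_
  rw [abs_sub_comm, abs_of_nonneg]
  have h1 : (2 : ℝ) ≤ A := by exact_mod_cast hA
  have h2 : (1 : ℝ) ≤ ((j : ℝ) + 1) ^ 2 := one_le_pow₀ (by linarith [Nat.cast_nonneg (α := ℝ) j])
  nlinarith

/-- The quotient is a product of factors `a / (a - 1) ≤ exp (2 / a)` with `a = A (j + 1)²`. The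
exponents sum to at most `4 / A ≤ 1`, and `exp (4 / A) ≤ 1 + 8 / A`. -/
theorem abs_nodeDist_zero_le_one {A : ℕ} (hA : 4 ≤ A) (d : ℕ) :
    |nodeDist A d 0| ≤ (1 + 8 / A) * |nodeDist A d 1| := by
  have hA' : (4 : ℝ) ≤ A := by exact_mod_cast hA
  have hsq : ∀ j : ℕ, (1 : ℝ) ≤ ((j : ℝ) + 1) ^ 2 := fun j =>
    one_le_pow₀ (by linarith [Nat.cast_nonneg (α := ℝ) j])
  have hpos : ∀ j : ℕ, (0 : ℝ) < A * ((j : ℝ) + 1) ^ 2 - 1 := fun j => by nlinarith [hsq j]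
  rw [abs_nodeDist_zero, abs_nodeDist_one (by omega)]
  have hfac : ∀ j ∈ Finset.range d, A * ((j : ℝ) + 1) ^ 2 ≤
      Real.exp (2 / A * (((j : ℝ) + 1) ^ 2)⁻¹) * (A * ((j : ℝ) + 1) ^ 2 - 1) := by
    intro j _
    have h1 := Real.add_one_le_exp (2 / A * (((j : ℝ) + 1) ^ 2)⁻¹)
    refine le_trans ?_ (mul_le_mul_of_nonneg_right h1 (hpos j).le)
    have h2 : (0 : ℝ) < ((j : ℝ) + 1) ^ 2 := by linarith [hsq j]
    have h3 : (0 : ℝ) < A := by linarith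
    have h4 : (2 / A * (((j : ℝ) + 1) ^ 2)⁻¹ + 1) * (A * ((j : ℝ) + 1) ^ 2 - 1) =
        A * ((j : ℝ) + 1) ^ 2 + (1 - 2 / (A * ((j : ℝ) + 1) ^ 2)) := by
      field_simp
      ring
    rw [h4]
    have : 2 / (A * ((j : ℝ) + 1) ^ 2) ≤ 1 := by
      rw [div_le_one (by positivity)]
      nlinarith [hsq j]
    linarith
  refine (Finset.prod_le_prod (fun j _ => by positivity) hfac).trans ?_
  rw [Finset.prod_mul_distrib, ← Real.exp_sum, ← Finset.mul_sum]
  refine mul_le_mul_of_nonneg_right ?_ (Finset.prod_nonneg fun j _ => (hpos j).le)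
  have h5 : 2 / (A : ℝ) * ∑ i ∈ Finset.range d, (((i : ℝ) + 1) ^ 2)⁻¹ ≤ 4 / A := by
    calc _ ≤ 2 / (A : ℝ) * 2 := by gcongr; exact sum_inv_sq_le d
      _ = 4 / A := by ring
  refine (Real.exp_le_exp.mpr h5).trans ?_
  have h6 : |4 / (A : ℝ)| ≤ 1 := by
    rw [abs_of_nonneg (by positivity), div_le_one (by linarith)]
    exact hA'
  have h7 := abs_le.mp (Real.abs_exp_sub_one_le h6)
  rw [abs_of_nonneg (by positivity : (0 : ℝ) ≤ 4 / A)] at h7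
  have : 8 / (A : ℝ) = 2 * (4 / A) := by ring
  linarith [h7.2]

/-- After cancelling the powers of `A`, the quotient is `U / (V * (a - 1))` with `a = A (i + 1)²`.
Here `U ≤ 2 * V`, and `2 / (a - 1) ≤ 4 / a`. These bounds are summable, so all nodes from `A` on
carry only `O(1/A)` of the mass at 0. -/
theorem abs_nodeDist_zero_le_add_two {A : ℕ} (hA : 4 ≤ A) {d i : ℕ} (hi : i < d) :
    |nodeDist A d 0| ≤ 4 / A * (((i : ℝ) + 1) ^ 2)⁻¹ * |nodeDist A d (i + 2)| := by
  have hA' : (4 : ℝ) ≤ A := by exact_mod_cast hA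
  have hsq : (1 : ℝ) ≤ ((i : ℝ) + 1) ^ 2 :=
    one_le_pow₀ (by linarith [Nat.cast_nonneg (α := ℝ) i])
  have hA0 : (0 : ℝ) < A := by linarith
  have hpos : (0 : ℝ) < A * ((i : ℝ) + 1) ^ 2 - 1 := by nlinarith
  set U := ∏ j ∈ Finset.range d, if j = i then (1 : ℝ) else ((j : ℝ) + 1) ^ 2 with hU
  set V := ∏ j ∈ Finset.range d,
    if j = i then (1 : ℝ) else |((i : ℝ) + 1) ^ 2 - ((j : ℝ) + 1) ^ 2| with hV
  set Q := ∏ j ∈ Finset.range d, if j = i then (1 : ℝ) else A with hQ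
  have hQ0 : 0 ≤ Q := Finset.prod_nonneg fun j _ => by split_ifs <;> positivity
  have hV0 : 0 ≤ V := Finset.prod_nonneg fun j _ => by split_ifs <;> positivity
  have h0 : |nodeDist A d 0| = A * ((i : ℝ) + 1) ^ 2 * (Q * U) := by
    rw [abs_nodeDist_zero, ← Finset.mul_prod_erase _ _ (Finset.mem_range.mpr hi),
      prod_erase_eq_prod_ite, hQ, hU, ← Finset.prod_mul_distrib]
    congr 1
    exact Finset.prod_congr rfl fun j _ => by split_ifs <;> simp
  have h1 : |nodeDist A d (i + 2)| =
      Q * V * (A * ((i : ℝ) + 1) ^ 2 - 1) * (A * ((i : ℝ) + 1) ^ 2) := by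
    rw [abs_nodeDist, if_neg (by omega), if_neg (by omega)]
    simp only [node]
    push_cast
    rw [abs_of_pos hpos, abs_of_nonneg (by positivity : (0 : ℝ) ≤ A * ((i : ℝ) + 1) ^ 2), hQ, hV,
      ← Finset.prod_mul_distrib]
    congr 2
    refine Finset.prod_congr rfl fun j _ => ?_
    by_cases hj : j = i
    · simp [hj]
    · rw [if_neg (by omega), if_neg hj, if_neg hj, ← mul_sub, abs_mul, abs_of_pos hA0]
  have h2 : U ≤ 2 * V := prod_sq_le_two_mul i d hi
  rw [h0, h1]
  have h3 : 2 * (A * ((i : ℝ) + 1) ^ 2) ≤ 4 * (A * ((i : ℝ) + 1) ^ 2 - 1) := by nlinarith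
  have h4 : 4 / A * (((i : ℝ) + 1) ^ 2)⁻¹ *
      (Q * V * (A * ((i : ℝ) + 1) ^ 2 - 1) * (A * ((i : ℝ) + 1) ^ 2)) =
      Q * V * (4 * (A * ((i : ℝ) + 1) ^ 2 - 1)) := by
    have : (0 : ℝ) < (i : ℝ) + 1 := by positivity
    field_simp
  rw [h4]
  calc A * ((i : ℝ) + 1) ^ 2 * (Q * U) ≤ A * ((i : ℝ) + 1) ^ 2 * (Q * (2 * V)) := by gcongr
    _ = Q * V * (2 * (A * ((i : ℝ) + 1) ^ 2)) := by ring
    _ ≤ _ := by gcongr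

theorem sum_abs_nodeDist_inv_le {A : ℕ} (hA : 4 ≤ A) (d : ℕ) :
    ∑ i ∈ Finset.range (d + 2), |nodeDist A d 0 / nodeDist A d i| ≤ 2 + 16 / A := by
  have hne := nodeDist_ne_zero (show 2 ≤ A by omega) d
  have hpos : ∀ i, 0 < |nodeDist A d i| := fun i => abs_pos.mpr (hne i)
  rw [Finset.sum_range_succ', Finset.sum_range_succ', div_self (hne 0), abs_one]
  have h1 : |nodeDist A d 0 / nodeDist A d (0 + 1)| ≤ 1 + 8 / A := by
    rw [abs_div, div_le_iff₀ (hpos _)]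
    exact abs_nodeDist_zero_le_one hA d
  have h2 : ∑ i ∈ Finset.range d, |nodeDist A d 0 / nodeDist A d (i + 1 + 1)| ≤ 8 / A := by
    calc _ ≤ ∑ i ∈ Finset.range d, 4 / (A : ℝ) * (((i : ℝ) + 1) ^ 2)⁻¹ := by
          refine Finset.sum_le_sum fun i hi => ?_
          rw [abs_div, div_le_iff₀ (hpos _)]
          exact abs_nodeDist_zero_le_add_two hA (Finset.mem_range.mp hi)
      _ ≤ 4 / (A : ℝ) * 2 := by
          rw [← Finset.mul_sum]
          gcongr
          exact sum_inv_sq_le d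
      _ = 8 / A := by ring
  have : 16 / (A : ℝ) = 8 / A + 8 / A := by ring
  linarith

open Polynomial in
-- The sum is a divided difference at `d + 2` nodes: the coefficient of degree `d + 1` of the
-- interpolating polynomial, which is `p` itself.
theorem sum_eval_div_nodeDist {A : ℕ} (hA : 2 ≤ A) (d : ℕ) (p : ℝ[X]) (hp : p.natDegree ≤ d) :
    ∑ i ∈ Finset.range (d + 2), p.eval (node A i : ℝ) / nodeDist A d i = 0 := by
  have hinj : Set.InjOn (fun i => (node A i : ℝ)) (Finset.range (d + 2)) :=
    (Nat.cast_injective.comp (node_strictMono hA).injective).injOn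
  have hdeg : p.degree < (Finset.range (d + 2)).card := by
    rw [Finset.card_range]
    refine (degree_le_of_natDegree_le hp).trans_lt ?_
    exact_mod_cast (by omega : d < d + 2)
  have := Lagrange.coeff_eq_sum hinj hdeg
  rw [Finset.card_range, coeff_eq_zero_of_natDegree_lt (by omega)] at this
  exact this.symm

open Polynomial in
/-- Weights on `{0, …, A d²}` that annihilate polynomials of degree at most `d` and have almost half
of their mass at `0`. -/
theorem exists_dual_weights {A d : ℕ} (hA : 4 ≤ A) (hd : 1 ≤ d) :
    ∃ w : ℕ → ℝ,
      (∀ p : ℝ[X], p.natDegree ≤ d →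
        ∑ t ∈ Finset.range (A * d ^ 2 + 1), w t * p.eval (t : ℝ) = 0) ∧
      ∑ t ∈ Finset.range (A * d ^ 2 + 1), |w t| ≤ 1 ∧ 1 - 8 / A ≤ 2 * w 0 := by
  have hA0 : (0 : ℝ) < A := by exact_mod_cast (by omega : 0 < A)
  have hM : (0 : ℝ) < 2 + 16 / A := by positivity
  have hne := nodeDist_ne_zero (show 2 ≤ A by omega) d
  have hmono := node_strictMono (show 2 ≤ A by omega)
  -- Divided-difference coefficients, scaled so that the total mass is at most 1 and `γ 0 = 1 / (2 +
  -- 16 / A)`.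
  let γ : ℕ → ℝ := fun i => nodeDist A d 0 / nodeDist A d i / (2 + 16 / A)
  have hmem : ∀ i ∈ Finset.range (d + 2), node A i ∈ Finset.range (A * d ^ 2 + 1) := by
    intro i hi
    have h1 : node A i ≤ node A (d + 1) := hmono.monotone (by
      have := Finset.mem_range.mp hi
      omega)
    obtain ⟨d, rfl⟩ := Nat.exists_eq_add_of_le' hd
    exact Finset.mem_range.mpr (Nat.lt_succ_of_le h1)
  have hsum : ∀ g : ℕ → ℝ, ∑ t ∈ Finset.range (A * d ^ 2 + 1),
      (∑ i ∈ Finset.range (d + 2), if node A i = t then γ i else 0) * g t =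
      ∑ i ∈ Finset.range (d + 2), γ i * g (node A i) := by
    intro g
    simp_rw [Finset.sum_mul]
    rw [Finset.sum_comm]
    refine Finset.sum_congr rfl fun i hi => ?_
    simp_rw [ite_mul, zero_mul]
    rw [Finset.sum_ite_eq, if_pos (hmem i hi)]
  refine ⟨fun t => ∑ i ∈ Finset.range (d + 2), if node A i = t then γ i else 0,
    fun p hp => ?_, ?_, ?_⟩
  · rw [hsum fun t => p.eval (t : ℝ)]
    have := sum_eval_div_nodeDist (show 2 ≤ A by omega) d p hp
    calc _ = ∑ i ∈ Finset.range (d + 2),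
          nodeDist A d 0 / (2 + 16 / A) * (p.eval (node A i : ℝ) / nodeDist A d i) :=
          Finset.sum_congr rfl fun i _ => by simp only [γ]; ring
      _ = 0 := by rw [← Finset.mul_sum, this, mul_zero]
  · calc _ ≤ ∑ t ∈ Finset.range (A * d ^ 2 + 1),
          ∑ i ∈ Finset.range (d + 2), if node A i = t then |γ i| else 0 := by
          refine Finset.sum_le_sum fun t _ => (Finset.abs_sum_le_sum_abs _ _).trans
            (Finset.sum_le_sum fun i _ => ?_)
          split_ifs <;> simp
      _ = ∑ i ∈ Finset.range (d + 2), |γ i| := by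
          rw [Finset.sum_comm]
          refine Finset.sum_congr rfl fun i hi => ?_
          rw [Finset.sum_ite_eq, if_pos (hmem i hi)]
      _ = (∑ i ∈ Finset.range (d + 2), |nodeDist A d 0 / nodeDist A d i|) / (2 + 16 / A) := by
          rw [Finset.sum_div]
          exact Finset.sum_congr rfl fun i _ => by rw [abs_div, abs_of_pos hM]
      _ ≤ 1 := by
          rw [div_le_one hM]
          exact sum_abs_nodeDist_inv_le hA d
  · have h0 : (∑ i ∈ Finset.range (d + 2), if node A i = 0 then γ i else 0) = γ 0 := by
      rw [Finset.sum_eq_single 0]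
      · simp [node]
      · intro i _ hi
        exact if_neg fun h => hi (hmono.injective h)
      · intro h
        exact absurd (Finset.mem_range.mpr (by omega)) h
    dsimp only
    rw [h0]
    simp only [γ]
    rw [div_self (hne 0), mul_one_div, le_div_iff₀ hM]
    have : (1 - 8 / (A : ℝ)) * (2 + 16 / A) = 2 - 2 * (8 / A) ^ 2 := by ring
    rw [this]
    linarith [sq_nonneg (8 / (A : ℝ))]

end NOF

namespace NOF

open scoped BigOperators Nat

/-! ### Symmetric functions on the cube -/

/-- Bit strings as sets. -/
def cubeEquivFinset (m : ℕ) : (Fin m → Bool) ≃ Finset (Fin m) where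
  toFun z := {j | z j = true}
  invFun s := fun j => decide (j ∈ s)
  left_inv z := by funext j; simp
  right_inv s := by ext j; simp

theorem sum_superset_card {m : ℕ} (P : Finset (Fin m)) (f : ℕ → ℝ) :
    ∑ s : Finset (Fin m) with P ⊆ s, f s.card =
      ∑ t ∈ Finset.range (m - P.card + 1), (m - P.card).choose t * f (t + P.card) := by
  have hc : Pᶜ.card = m - P.card := by rw [Finset.card_compl, Fintype.card_fin]
  have h1 := Finset.sum_powerset_apply_card (fun t => f (t + P.card)) (x := Pᶜ)
  simp only [hc, nsmul_eq_mul] at h1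
  rw [← h1]
  refine Finset.sum_bij' (fun s _ => s \ P) (fun s _ => s ∪ P) (fun s _ => ?_) (fun s _ => ?_)
    (fun s hs => ?_) (fun s hs => ?_) (fun s hs => ?_)
  · rw [Finset.mem_powerset, Finset.subset_compl_iff_disjoint_right]
    exact Finset.sdiff_disjoint
  · simp
  · exact Finset.sdiff_union_of_subset (Finset.mem_filter.mp hs).2
  · rw [Finset.mem_powerset, Finset.subset_compl_iff_disjoint_right] at hs
    exact Finset.union_sdiff_cancel_right hs
  · congr 1
    exact (Finset.card_sdiff_add_card_eq_card (Finset.mem_filter.mp hs).2).symm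

theorem choose_mul_div_choose {m s t : ℕ} (h : t + s ≤ m) :
    ((m - s).choose t : ℝ) * ((m.choose (t + s) : ℝ))⁻¹ =
      ((t + s).choose s : ℝ) * ((m.choose s : ℝ))⁻¹ := by
  have h1 := Nat.choose_mul (n := m) (Nat.le_add_left s t)
  rw [Nat.add_sub_cancel] at h1
  have h2 : (m.choose (t + s) : ℝ) ≠ 0 := by exact_mod_cast (Nat.choose_pos h).ne'
  have h3 : (m.choose s : ℝ) ≠ 0 := by exact_mod_cast (Nat.choose_pos (by omega)).ne'
  have h4 : (m.choose (t + s) : ℝ) * (t + s).choose s = m.choose s * (m - s).choose t := by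
    exact_mod_cast h1
  field_simp
  linarith

/-- The function on subsets obtained by spreading the weight `w t` evenly over the sets of size
`t`. -/
noncomputable def spread (m : ℕ) (w : ℕ → ℝ) (s : Finset (Fin m)) : ℝ :=
  w s.card * ((m.choose s.card : ℝ))⁻¹

/-- By double counting, the sum is a constant times `∑ w t * (t choose |P|)`, and the binomial is a
polynomial in `t` of degree `|P| ≤ d`. -/
theorem sum_spread_superset {m d : ℕ} {w : ℕ → ℝ}
    (hw : ∀ p : Polynomial ℝ, p.natDegree ≤ d →
      ∑ t ∈ Finset.range (m + 1), w t * p.eval (t : ℝ) = 0)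
    (P : Finset (Fin m)) (hP : P.card ≤ d) :
    ∑ s : Finset (Fin m) with P ⊆ s, spread m w s = 0 := by
  have hPm : P.card ≤ m := by simpa using P.card_le_univ
  simp only [spread]
  rw [sum_superset_card P fun t => w t * ((m.choose t : ℝ))⁻¹]
  have h1 : ∀ t ∈ Finset.range (m - P.card + 1),
      ((m - P.card).choose t : ℝ) * (w (t + P.card) * ((m.choose (t + P.card) : ℝ))⁻¹) =
      ((m.choose P.card : ℝ))⁻¹ * (w (t + P.card) * (t + P.card).choose P.card) := by
    intro t ht
    have := choose_mul_div_choose (m := m) (s := P.card) (t := t) (by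
      have := Finset.mem_range.mp ht
      omega)
    linear_combination w (t + P.card) * this
  rw [Finset.sum_congr rfl h1, ← Finset.mul_sum]
  have h2 : ∑ t ∈ Finset.range (m - P.card + 1),
      w (t + P.card) * ((t + P.card).choose P.card : ℝ) =
      ∑ t ∈ Finset.range (m + 1), w t * (t.choose P.card : ℝ) := by
    rw [show m + 1 = P.card + (m - P.card + 1) by omega, Finset.sum_range_add _ P.card,
      Finset.sum_eq_zero (s := Finset.range P.card), zero_add]
    · exact Finset.sum_congr rfl fun t _ => by rw [add_comm]
    · intro t ht
      rw [Nat.choose_eq_zero_of_lt (Finset.mem_range.mp ht)]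
      simp
  have h3 := hw (Polynomial.C ((P.card ! : ℝ))⁻¹ * descPochhammer ℝ P.card) (by
    refine (Polynomial.natDegree_C_mul_le _ _).trans ?_
    rw [descPochhammer_natDegree]
    exact hP)
  rw [h2, mul_eq_zero]
  right
  rw [← h3]
  refine Finset.sum_congr rfl fun t _ => ?_
  rw [Nat.cast_choose_eq_descPochhammer_div ℝ t P.card, Polynomial.eval_mul, Polynomial.eval_C]
  ring

/-- Inclusion-exclusion, one element of `Q` at a time: sets avoiding `q` are all sets minus those
containing `q`. The total size of the constraints stays at most `d`. -/
theorem sum_spread_superset_disjoint {m d : ℕ} {w : ℕ → ℝ}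
    (hw : ∀ p : Polynomial ℝ, p.natDegree ≤ d →
      ∑ t ∈ Finset.range (m + 1), w t * p.eval (t : ℝ) = 0)
    (Q P : Finset (Fin m)) (h : P.card + Q.card ≤ d) :
    ∑ s : Finset (Fin m) with P ⊆ s ∧ Disjoint Q s, spread m w s = 0 := by
  induction Q using Finset.induction_on generalizing P with
  | empty => simpa using sum_spread_superset hw P (by simpa using h)
  | insert q Q hq ih =>
    rw [Finset.card_insert_of_notMem hq] at h
    have h1 := ih P (by omega)
    have h2 := ih (insert q P) (by
      have := Finset.card_insert_le q P
      omega)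
    rw [← Finset.sum_filter_add_sum_filter_not _ fun s => q ∈ s, Finset.filter_filter,
      Finset.filter_filter] at h1
    have e1 : (Finset.univ.filter fun s : Finset (Fin m) => (P ⊆ s ∧ Disjoint Q s) ∧ q ∈ s) =
        Finset.univ.filter fun s => insert q P ⊆ s ∧ Disjoint Q s := by
      refine Finset.filter_congr fun s _ => ?_
      rw [Finset.insert_subset_iff]
      tauto
    have e2 : (Finset.univ.filter fun s : Finset (Fin m) => (P ⊆ s ∧ Disjoint Q s) ∧ ¬ q ∈ s) =
        Finset.univ.filter fun s => P ⊆ s ∧ Disjoint (insert q Q) s := by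
      refine Finset.filter_congr fun s _ => ?_
      rw [Finset.disjoint_insert_left]
      tauto
    rw [e1, e2, h2, zero_add] at h1
    exact h1

/-- `ψ` is orthogonal to all functions that depend on at most `d` bits. -/
def JuntaOrthogonal {m : ℕ} (d : ℕ) (ψ : (Fin m → Bool) → ℝ) : Prop :=
  ∀ (B : Finset (Fin m)) (a : Fin m → Bool), B.card ≤ d →
    ∑ z : Fin m → Bool with ∀ j ∈ B, z j = a j, ψ z = 0

/-- A dual polynomial for `OR`: it certifies that `OR` on `A d²` bits has no approximation of
degree `d`. -/
theorem exists_dual_OR {A d : ℕ} (hA : 4 ≤ A) (hd : 1 ≤ d) :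
    ∃ ψ : (Fin (A * d ^ 2) → Bool) → ℝ, JuntaOrthogonal d ψ ∧ ∑ z, |ψ z| ≤ 1 ∧
      1 - 8 / A ≤ 2 * ψ fun _ => false := by
  obtain ⟨w, hw, habs, h0⟩ := exists_dual_weights hA hd
  set m := A * d ^ 2
  refine ⟨fun z => spread m w (cubeEquivFinset m z), fun B a hB => ?_, ?_, ?_⟩
  · rw [← sum_spread_superset_disjoint hw (B.filter fun j => a j = false)
      (B.filter fun j => a j = true) (by
        refine le_trans (le_of_eq ?_) hB
        rw [← Finset.card_filter_add_card_filter_not (s := B) fun j => a j = true]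
        simp)]
    refine Finset.sum_equiv (cubeEquivFinset m) (fun z => ?_) (fun _ _ => rfl)
    simp only [Finset.mem_filter, Finset.mem_univ, true_and, cubeEquivFinset, Equiv.coe_fn_mk,
      Finset.subset_iff, Finset.disjoint_left]
    constructor
    · intro h
      refine ⟨fun j hj => (h j hj.1).trans hj.2, fun j hj => ?_⟩
      rw [h j hj.1, hj.2]
      simp
    · rintro ⟨h1, h2⟩ j hj
      cases ha : a j
      · simpa using h2 (a := j) ⟨hj, ha⟩
      · exact h1 ⟨hj, ha⟩
  · rw [(cubeEquivFinset m).sum_comp fun s => |spread m w s|]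
    refine le_trans (le_of_eq ?_) habs
    have h1 := sum_superset_card (m := m) ∅ fun t => |w t| * ((m.choose t : ℝ))⁻¹
    simp only [Finset.empty_subset, Finset.filter_true, Finset.card_empty, Nat.sub_zero,
      add_zero] at h1
    calc ∑ s, |spread m w s| = ∑ s : Finset (Fin m), |w s.card| * ((m.choose s.card : ℝ))⁻¹ := by
          refine Finset.sum_congr rfl fun s _ => ?_
          rw [spread, abs_mul, abs_of_nonneg (by positivity : (0 : ℝ) ≤ ((m.choose s.card : ℝ))⁻¹)]
      _ = _ := h1
      _ = _ := by
          refine Finset.sum_congr rfl fun t ht => ?_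
          have : (m.choose t : ℝ) ≠ 0 := by
            exact_mod_cast (Nat.choose_pos (Nat.lt_succ_iff.mp (Finset.mem_range.mp ht))).ne'
          field_simp
  · simpa [spread, cubeEquivFinset] using h0

/-! ### Selecting one bit from each block -/

theorem expect_comp_injective {α β : Type*} [Fintype α] [Fintype β] [DecidableEq α]
    [DecidableEq β] {ι : α → β} (hι : Function.Injective ι) (g : (α → Bool) → ℝ) :
    𝔼 x : β → Bool, g (x ∘ ι) = 𝔼 z, g z := by
  classical
  let e : α ⊕ ↥(Set.range ι)ᶜ ≃ β :=
    (Equiv.sumCongr (Equiv.ofInjective ι hι) (Equiv.refl _)).trans (Equiv.Set.sumCompl _)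
  have he : ∀ a, e (Sum.inl a) = ι a := fun a => by simp [e]
  rw [← expect_univ_equiv (e.arrowCongr (Equiv.refl Bool)),
    ← expect_univ_equiv (Equiv.sumArrowEquivProdArrow α ↥(Set.range ι)ᶜ Bool).symm,
    expect_prod_type]
  refine Finset.expect_congr rfl fun z _ => ?_
  have h1 : ∀ y : ↥(Set.range ι)ᶜ → Bool, (e.arrowCongr (Equiv.refl Bool)
      ((Equiv.sumArrowEquivProdArrow α ↥(Set.range ι)ᶜ Bool).symm (z, y))) ∘ ι = z := by
    intro y
    funext a
    simp [← he]
  simp only [h1]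
  exact Finset.expect_const Finset.univ_nonempty _

variable {K m l : ℕ}

/-- The selected bits: from the `j`-th block, a cube of side `l` and dimension `K`, the bit with
coordinates `S i j`. -/
def select (x : Fin m × (Fin K → Fin l) → Bool) (S : Fin K → Fin m → Fin l) : Fin m → Bool :=
  fun j => x (j, fun i => S i j)

/-- The blocks in which two choices agree in some coordinate. -/
def badBlocks (S : Fin K → Bool → Fin m → Fin l) : Finset (Fin m) :=
  {j | ∃ i, S i false j = S i true j}

theorem eq_of_notMem_badBlocks {S : Fin K → Bool → Fin m → Fin l} {j : Fin m}
    (hj : j ∉ badBlocks S) {u v : Fin K → Bool}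
    (h : (fun i => S i (u i) j) = fun i => S i (v i) j) : u = v := by
  simp only [badBlocks, Finset.mem_filter, Finset.mem_univ, true_and, not_exists] at hj
  funext i
  have hi := congrFun h i
  have := hj i
  cases hu : u i <;> cases hv : v i <;> simp_all

theorem expect_select (S : Fin K → Fin m → Fin l) (g : (Fin m → Bool) → ℝ) :
    𝔼 x : Fin m × (Fin K → Fin l) → Bool, g (select x S) = 𝔼 z, g z :=
  expect_comp_injective (ι := fun j : Fin m => (j, fun i => S i j))
    (fun _ _ h => (Prod.mk.inj h).1) g

/-- In a good block the `2 ^ K` choices point to distinct bits, so the bit chosen by `u₀` can be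
flipped without affecting the other factors. Averaging over all flips in good blocks leaves a sum of
`ψ` over strings with prescribed bits in the at most `d` bad blocks, which is zero. -/
theorem expect_prod_select_eq_zero {d : ℕ} {ψ : (Fin m → Bool) → ℝ} (hψ : JuntaOrthogonal d ψ)
    (S : Fin K → Bool → Fin m → Fin l) (hS : (badBlocks S).card ≤ d) :
    𝔼 x : Fin m × (Fin K → Fin l) → Bool,
      ∏ u : Fin K → Bool, ψ (select x fun i => S i (u i)) = 0 := by
  set u₀ : Fin K → Bool := fun _ => false
  -- `flip g` changes, in each block `j` with `g j = true`, the bit selected by `u₀`.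
  let flip : (Fin m → Bool) → (Fin m × (Fin K → Fin l) → Bool) →
      Fin m × (Fin K → Fin l) → Bool := fun g x p =>
    xor (x p) (g p.1 && decide (p.2 = fun i => S i (u₀ i) p.1))
  have hflip : ∀ g, Function.Involutive (flip g) := fun g x => by
    funext p
    simp [flip]
  let good : Finset (Fin m → Bool) := {g | ∀ j ∈ badBlocks S, g j = false}
  have hne : good.Nonempty := ⟨fun _ => false, by simp [good]⟩
  have h0 : ∀ g x, select (flip g x) (fun i => S i (u₀ i)) =
      fun j => xor (select x (fun i => S i (u₀ i)) j) (g j) := fun g x => by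
    funext j
    simp [select, flip]
  have h1 : ∀ g ∈ good, ∀ x, ∀ u ≠ u₀, select (flip g x) (fun i => S i (u i)) =
      select x fun i => S i (u i) := fun g hg x u hu => by
    funext j
    simp only [select, flip]
    by_cases hj : j ∈ badBlocks S
    · simp [(Finset.mem_filter.mp hg).2 j hj]
    · have : ¬ ((fun i => S i (u i) j) = fun i => S i (u₀ i) j) :=
        fun h => hu (eq_of_notMem_badBlocks hj h)
      simp [this]
  have h2 : ∀ z : Fin m → Bool, ∑ g ∈ good, ψ (fun j => xor (z j) (g j)) = 0 := fun z => by
    rw [← hψ (badBlocks S) z hS]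
    refine Finset.sum_bij' (fun g _ j => xor (z j) (g j)) (fun g _ j => xor (z j) (g j))
      (fun g hg => ?_) (fun g hg => ?_) (fun g _ => ?_) (fun g _ => ?_) (fun _ _ => rfl)
    · rw [Finset.mem_filter] at hg ⊢
      exact ⟨Finset.mem_univ _, fun j hj => by simp [hg.2 j hj]⟩
    · rw [Finset.mem_filter] at hg ⊢
      exact ⟨Finset.mem_univ _, fun j hj => by simp [hg.2 j hj]⟩
    · funext j
      simp
    · funext j
      simp
  have h3 : ∀ g ∈ good, 𝔼 x, ∏ u : Fin K → Bool, ψ (select x fun i => S i (u i)) =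
      𝔼 x, ψ (fun j => xor (select x (fun i => S i (u₀ i)) j) (g j)) *
        ∏ u ∈ Finset.univ.erase u₀, ψ (select x fun i => S i (u i)) := fun g hg => by
    rw [← expect_univ_equiv (hflip g).toPerm]
    refine Finset.expect_congr rfl fun x _ => ?_
    rw [← Finset.mul_prod_erase _ _ (Finset.mem_univ u₀)]
    simp only [Function.Involutive.coe_toPerm]
    rw [h0]
    congr 1
    exact Finset.prod_congr rfl fun u hu => by rw [h1 g hg x u (Finset.mem_erase.mp hu).1]
  have h4 : (good.card : ℝ) * 𝔼 x, ∏ u : Fin K → Bool, ψ (select x fun i => S i (u i)) = 0 := by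
    rw [← nsmul_eq_mul, ← Finset.sum_const, Finset.sum_congr rfl h3, ← Finset.expect_sum_comm]
    refine Finset.expect_eq_zero fun x _ => ?_
    rw [← Finset.sum_mul, h2, zero_mul]
  exact (mul_eq_zero.mp h4).resolve_left (by exact_mod_cast hne.card_pos.ne')

/-- The bits selected in good blocks are distinct, hence independent. So any prescribed family of
selected strings has probability at most `2 ^ (-2 ^ K * (m - b))`, with `b` bad blocks. The sum of
`∏ u, |ψ (Z u)|` over all families is a power of the ℓ¹-norm. -/
theorem abs_expect_prod_select_le {ψ : (Fin m → Bool) → ℝ} (hψ : ∑ z, |ψ z| ≤ 1)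
    (S : Fin K → Bool → Fin m → Fin l) :
    |𝔼 x : Fin m × (Fin K → Fin l) → Bool,
      ∏ u : Fin K → Bool, ψ (select x fun i => S i (u i))| * (2 ^ 2 ^ K) ^ m ≤
      (2 ^ 2 ^ K) ^ (badBlocks S).card := by
  classical
  let α := (Fin K → Bool) × {j // j ∉ badBlocks S}
  let ι : α → Fin m × (Fin K → Fin l) := fun p => (p.2, fun i => S i (p.1 i) p.2)
  have hι : Function.Injective ι := by
    rintro ⟨u, j⟩ ⟨v, j'⟩ h
    obtain ⟨h1, h2⟩ := Prod.mk.inj h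
    obtain rfl : j = j' := Subtype.ext h1
    exact Prod.ext (eq_of_notMem_badBlocks j.2 h2) rfl
  have hcard : Fintype.card (α → Bool) = (2 ^ 2 ^ K) ^ (m - (badBlocks S).card) := by
    have : Fintype.card {j // j ∉ badBlocks S} = m - (badBlocks S).card := by
      rw [Fintype.card_subtype_compl]
      simp
    rw [Fintype.card_fun, Fintype.card_bool, Fintype.card_prod, this, pow_mul]
    simp
  have hprob : ∀ Z : (Fin K → Bool) → Fin m → Bool,
      𝔼 x : Fin m × (Fin K → Fin l) → Bool,
        (if ∀ u, select x (fun i => S i (u i)) = Z u then (1 : ℝ) else 0) ≤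
      ((2 ^ 2 ^ K) ^ (m - (badBlocks S).card))⁻¹ := fun Z => by
    let a : α → Bool := fun p => Z p.1 p.2
    calc _ ≤ 𝔼 x : Fin m × (Fin K → Fin l) → Bool, (if x ∘ ι = a then (1 : ℝ) else 0) := by
          refine Finset.expect_le_expect fun x _ => ?_
          by_cases h : ∀ u, select x (fun i => S i (u i)) = Z u
          · rw [if_pos h, if_pos]
            funext p
            exact congrFun (h p.1) p.2
          · rw [if_neg h]
            split_ifs <;> norm_num
      _ = 𝔼 z : α → Bool, (if z = a then (1 : ℝ) else 0) :=
          expect_comp_injective hι fun z => if z = a then (1 : ℝ) else 0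
      _ = _ := by
          rw [Fintype.expect_eq_sum_div_card, hcard, Finset.sum_ite_eq', if_pos (Finset.mem_univ a)]
          simp
  have h1 : |𝔼 x : Fin m × (Fin K → Fin l) → Bool,
      ∏ u : Fin K → Bool, ψ (select x fun i => S i (u i))| ≤
      ((2 ^ 2 ^ K) ^ (m - (badBlocks S).card))⁻¹ := by
    calc _ ≤ 𝔼 x : Fin m × (Fin K → Fin l) → Bool,
          ∏ u : Fin K → Bool, |ψ (select x fun i => S i (u i))| := by
          refine (Finset.abs_expect_le _ _).trans (le_of_eq ?_)
          exact Finset.expect_congr rfl fun x _ => Finset.abs_prod _ _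
      _ = 𝔼 x : Fin m × (Fin K → Fin l) → Bool, ∑ Z : (Fin K → Bool) → Fin m → Bool,
          (if ∀ u, select x (fun i => S i (u i)) = Z u then (1 : ℝ) else 0) * ∏ u, |ψ (Z u)| := by
          refine Finset.expect_congr rfl fun x _ => ?_
          rw [Finset.sum_eq_single fun u => select x fun i => S i (u i)]
          · simp
          · intro Z _ hZ
            rw [if_neg fun h => hZ (funext fun u => (h u).symm), zero_mul]
          · simp
      _ = ∑ Z : (Fin K → Bool) → Fin m → Bool, (𝔼 x : Fin m × (Fin K → Fin l) → Bool,
          (if ∀ u, select x (fun i => S i (u i)) = Z u then (1 : ℝ) else 0)) * ∏ u, |ψ (Z u)| := by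
          rw [Finset.expect_sum_comm]
          exact Finset.sum_congr rfl fun Z _ => by rw [Finset.expect_mul]
      _ ≤ ∑ Z : (Fin K → Bool) → Fin m → Bool,
          ((2 ^ 2 ^ K) ^ (m - (badBlocks S).card))⁻¹ * ∏ u, |ψ (Z u)| := by
          refine Finset.sum_le_sum fun Z _ => mul_le_mul_of_nonneg_right (hprob Z) ?_
          exact Finset.prod_nonneg fun u _ => abs_nonneg _
      _ = ((2 ^ 2 ^ K) ^ (m - (badBlocks S).card))⁻¹ * (∑ z, |ψ z|) ^ Fintype.card (Fin K → Bool) := by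
          rw [← Finset.mul_sum]
          congr 1
          rw [← Finset.card_univ, ← Finset.prod_const, Finset.prod_univ_sum, Fintype.piFinset_univ]
      _ ≤ _ := mul_le_of_le_one_right (by positivity)
          (pow_le_one₀ (Finset.sum_nonneg fun _ _ => abs_nonneg _) hψ)
  have hb : (badBlocks S).card ≤ m := by simpa using (badBlocks S).card_le_univ
  calc _ ≤ ((2 ^ 2 ^ K) ^ (m - (badBlocks S).card))⁻¹ * (2 ^ 2 ^ K : ℝ) ^ m := by gcongr
    _ = _ := by
      rw [← pow_sub_mul_pow (2 ^ 2 ^ K : ℝ) hb, ← mul_assoc, inv_mul_cancel₀ (by positivity),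
        one_mul]

/-- The number of agreements of two independent choices has small exponential moments. -/
theorem expect_pow_badBlocks_le (hl : 0 < l) {q : ℝ} (hq : 1 ≤ q) :
    𝔼 S : Fin K → Bool → Fin m → Fin l, q ^ (badBlocks S).card ≤ Real.exp (K * m * (q / l)) := by
  classical
  have hl' : (0 : ℝ) < l := by exact_mod_cast hl
  let r : (Bool → Fin l) → ℝ := fun s => if s false = s true then q else 1
  -- Every bad block contributes a factor `q` for at least one of its coordinates, so the power is
  -- dominated by a product of independent factors.
  have h1 : ∀ S : Fin K → Bool → Fin m → Fin l,
      q ^ (badBlocks S).card ≤ ∏ p : Fin K × Fin m, r fun b => S p.1 b p.2 := fun S => by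
    have hr : ∀ s, 1 ≤ r s := fun s => by
      simp only [r]
      split_ifs <;> simp [hq]
    rw [Fintype.prod_prod_type_right]
    calc q ^ (badBlocks S).card = ∏ j, if j ∈ badBlocks S then q else 1 := by
          rw [Finset.prod_ite_mem, Finset.univ_inter, Finset.prod_const]
      _ ≤ _ := by
          refine Finset.prod_le_prod (fun j _ => by split_ifs <;> linarith) fun j _ => ?_
          split_ifs with hj
          · obtain ⟨i₀, hi₀⟩ := (Finset.mem_filter.mp hj).2
            calc q = ∏ i : Fin K, if i = i₀ then q else 1 := by simp
              _ ≤ _ := by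
                refine Finset.prod_le_prod (fun i _ => by split_ifs <;> linarith) fun i _ => ?_
                split_ifs with hi
                · subst hi
                  simp [r, hi₀]
                · exact hr fun b => S i b j
          · calc (1 : ℝ) = ∏ i : Fin K, 1 := by simp
              _ ≤ _ := Finset.prod_le_prod (fun _ _ => zero_le_one) fun i _ =>
                hr fun b => S i b j
  let e : (Fin K → Bool → Fin m → Fin l) ≃ (Fin K × Fin m → Bool → Fin l) :=
    { toFun := fun S p b => S p.1 b p.2
      invFun := fun T i b j => T (i, j) b
      left_inv := fun _ => rfl
      right_inv := fun _ => rfl }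
  have h2 : 𝔼 s, r s ≤ 1 + q / l := by
    have : Nonempty (Fin l) := ⟨⟨0, hl⟩⟩
    rw [expect_bool_arrow]
    refine Finset.expect_le Finset.univ_nonempty fun y _ => ?_
    calc 𝔼 y', r (fun b => cond b y' y) ≤ 𝔼 y' : Fin l, (1 + if y = y' then q else 0) := by
          refine Finset.expect_le_expect fun y' _ => ?_
          simp only [r, cond]
          split_ifs <;> linarith
      _ = 1 + q / l := by
          rw [Finset.expect_add_distrib, Finset.expect_const Finset.univ_nonempty,
            Fintype.expect_eq_sum_div_card]
          simp
  have hr0 : 0 ≤ 𝔼 s, r s := Finset.expect_nonneg fun s _ => by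
    simp only [r]
    split_ifs <;> linarith
  calc 𝔼 S : Fin K → Bool → Fin m → Fin l, q ^ (badBlocks S).card
      ≤ 𝔼 S, ∏ p : Fin K × Fin m, r (e S p) := Finset.expect_le_expect fun S _ => h1 S
    _ = 𝔼 T : Fin K × Fin m → Bool → Fin l, ∏ p, r (T p) :=
        expect_univ_equiv e fun T => ∏ p, r (T p)
    _ = (𝔼 s, r s) ^ (K * m) := by
        rw [Fintype.expect_eq_sum_div_card, Fintype.expect_eq_sum_div_card, div_pow,
          Fintype.card_fun]
        have h3 : ∑ T : Fin K × Fin m → Bool → Fin l, ∏ p, r (T p) =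
            (∑ s, r s) ^ Fintype.card (Fin K × Fin m) := by
          rw [← Finset.card_univ, ← Finset.prod_const, Finset.prod_univ_sum, Fintype.piFinset_univ]
        rw [h3, Fintype.card_prod, Fintype.card_fin, Fintype.card_fin]
        push_cast
        rfl
    _ ≤ Real.exp (q / l) ^ (K * m) := by
        refine pow_le_pow_left₀ hr0 (h2.trans ?_) _
        rw [add_comm]
        exact Real.add_one_le_exp _
    _ = _ := by
        rw [← Real.exp_nat_mul]
        push_cast
        rfl

end NOF

namespace NOF

open scoped BigOperators

/-! ### From randomized to deterministic protocols -/

/-- The mean output differs from `f` by at most `1 - 2 * ε` on every input; averaging against `Ψ`,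
some protocol in the support does at least as well as the mean. -/
theorem RandomizedWithin.exists_protocol {k : ℕ} {X W : Type} [Fintype W] [Nonempty W] {ε : ℝ}
    {f : (Fin k → X) → ℤˣ} {c : ℕ} (h : RandomizedWithin ε f c) (Ψ : W → ℝ)
    (hΨ : ∑ w, |Ψ w| ≤ 1) (e : W → Fin k → X) :
    ∃ P : Protocol k X, (∀ x, P.bits x ≤ c) ∧
      ∑ w, Ψ w * ((f (e w) : ℤ) : ℝ) - (1 - 2 * ε) ≤
        ∑ w, Ψ w * ((P.eval (e w) : ℤ) : ℝ) := by
  classical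
  obtain ⟨μ, hbits, hμ⟩ := h
  -- Only the outputs on `W` matter; passing to the finite type `W → ℤˣ` makes all averages finite
  -- sums.
  let ν : PMF (W → ℤˣ) := μ.map fun P w => P.eval (e w)
  let p : (W → ℤˣ) → ℝ := fun g => (ν g).toReal
  have hp0 : ∀ g, 0 ≤ p g := fun g => ENNReal.toReal_nonneg
  have hp1 : ∑ g, p g = 1 := by
    rw [← ENNReal.toReal_sum fun g _ => ν.apply_ne_top g, ← tsum_fintype (L := .unconditional _),
      ν.tsum_coe, ENNReal.toReal_one]
  have hprob : ∀ w, 1 / 2 + ε ≤ ∑ g, if g w = f (e w) then p g else 0 := fun w => by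
    refine (hμ (e w)).trans (le_of_eq ?_)
    have h1 : μ.map (fun P => P.eval (e w)) = ν.map fun g => g w := by
      rw [PMF.map_comp]
      rfl
    rw [h1, PMF.map_apply, tsum_fintype, ENNReal.toReal_sum]
    · refine Finset.sum_congr rfl fun g _ => ?_
      by_cases hg : g w = f (e w)
      · rw [if_pos hg, if_pos hg.symm]
      · rw [if_neg hg, if_neg (Ne.symm hg), ENNReal.toReal_zero]
    · intro g _
      split_ifs
      · exact ν.apply_ne_top g
      · exact ENNReal.zero_ne_top
  have hmean : ∀ w, |∑ g, p g * ((g w : ℤ) : ℝ) - ((f (e w) : ℤ) : ℝ)| ≤ 1 - 2 * ε := fun w => by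
    have hval : ∀ u v : ℤˣ, ((u : ℤ) : ℝ) * ((v : ℤ) : ℝ) = 2 * (if u = v then 1 else 0) - 1 := by
      intro u v
      rcases Int.units_eq_one_or u with rfl | rfl <;> rcases Int.units_eq_one_or v with rfl | rfl <;>
        norm_num [show ¬ ((1 : ℤˣ) = -1) by decide, show ¬ ((-1 : ℤˣ) = 1) by decide]
    have habs : |((f (e w) : ℤ) : ℝ)| = 1 := by
      rcases Int.units_eq_one_or (f (e w)) with hf | hf <;> simp [hf]
    have h1 : (∑ g, p g * ((g w : ℤ) : ℝ) - ((f (e w) : ℤ) : ℝ)) * ((f (e w) : ℤ) : ℝ) =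
        2 * (∑ g, if g w = f (e w) then p g else 0) - 2 := by
      rw [sub_mul, hval, if_pos rfl, Finset.sum_mul]
      have : ∀ g, p g * ((g w : ℤ) : ℝ) * ((f (e w) : ℤ) : ℝ) =
          2 * (if g w = f (e w) then p g else 0) - p g := fun g => by
        rw [mul_assoc, hval]
        split_ifs <;> ring
      simp only [this]
      rw [Finset.sum_sub_distrib, hp1, ← Finset.mul_sum]
      ring
    have h2 : (∑ g, if g w = f (e w) then p g else 0) ≤ 1 := by
      rw [← hp1]
      refine Finset.sum_le_sum fun g _ => ?_
      split_ifs
      · exact le_rfl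
      · exact hp0 g
    rw [← mul_one |_|, ← habs, ← abs_mul, h1, abs_of_nonpos (by linarith)]
    linarith [hprob w]
  have hε : 0 ≤ 1 - 2 * ε := (abs_nonneg _).trans (hmean (Classical.arbitrary W))
  set T := ∑ w, Ψ w * ((f (e w) : ℤ) : ℝ) - (1 - 2 * ε) with hT
  have hswap : ∑ g, p g * ∑ w, Ψ w * ((g w : ℤ) : ℝ) =
      ∑ w, Ψ w * ∑ g, p g * ((g w : ℤ) : ℝ) := by
    simp only [Finset.mul_sum]
    rw [Finset.sum_comm]
    exact Finset.sum_congr rfl fun _ _ => Finset.sum_congr rfl fun _ _ => by ring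
  have havg : T ≤ ∑ g, p g * ∑ w, Ψ w * ((g w : ℤ) : ℝ) := by
    have h1 : |∑ w, Ψ w * (∑ g, p g * ((g w : ℤ) : ℝ) - ((f (e w) : ℤ) : ℝ))| ≤ 1 - 2 * ε := by
      calc _ ≤ ∑ w, |Ψ w| * (1 - 2 * ε) := by
            refine (Finset.abs_sum_le_sum_abs _ _).trans (Finset.sum_le_sum fun w _ => ?_)
            rw [abs_mul]
            exact mul_le_mul_of_nonneg_left (hmean w) (abs_nonneg _)
        _ ≤ _ := by
            rw [← Finset.sum_mul]
            exact mul_le_of_le_one_left hε hΨ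
    simp only [mul_sub] at h1
    rw [Finset.sum_sub_distrib] at h1
    rw [hswap]
    linarith [(abs_le.mp h1).1]
  by_contra! hcon
  have hlt : ∀ g ∈ ν.support, ∑ w, Ψ w * ((g w : ℤ) : ℝ) < T := fun g hg => by
    obtain ⟨P, hP, rfl⟩ := (PMF.mem_support_map_iff _ _ _).mp hg
    exact hcon P (hbits P hP)
  obtain ⟨g₀, hg₀⟩ := ν.support_nonempty
  have hpos : 0 < ∑ g, p g * (T - ∑ w, Ψ w * ((g w : ℤ) : ℝ)) := by
    refine Finset.sum_pos' (fun g _ => ?_) ⟨g₀, Finset.mem_univ _, ?_⟩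
    · by_cases hg : g ∈ ν.support
      · exact mul_nonneg (hp0 g) (sub_nonneg.mpr (hlt g hg).le)
      · have : p g = 0 := by
          simp only [p]
          rw [(PMF.apply_eq_zero_iff _ _).mpr hg, ENNReal.toReal_zero]
        rw [this, zero_mul]
    · refine mul_pos ?_ (sub_pos.mpr (hlt g₀ hg₀))
      exact ENNReal.toReal_pos ((PMF.mem_support_iff _ _).mp hg₀) (ν.apply_ne_top g₀)
  simp only [mul_sub] at hpos
  rw [Finset.sum_sub_distrib, ← Finset.sum_mul, hp1] at hpos
  linarith

/-- A protocol without communication is constant, so it is uncorrelated with the weight `± 1/2` on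
two inputs of opposite value. -/
theorem RandomizedWithin.pos_of_ne {k : ℕ} {X : Type} {ε : ℝ} (hε : 0 < ε)
    {f : (Fin k → X) → ℤˣ} {c : ℕ} (h : RandomizedWithin ε f c) {x y : Fin k → X}
    (hxy : f x ≠ f y) : 1 ≤ c := by
  by_contra! hc
  obtain rfl : c = 0 := by omega
  let e : Bool → Fin k → X := fun b => cond b x y
  obtain ⟨P, hP, hT⟩ := h.exists_protocol (fun b => ((f (e b) : ℤ) : ℝ) / 2) (by
    rcases Int.units_eq_one_or (f x) with hx | hx <;>
    rcases Int.units_eq_one_or (f y) with hy | hy <;> norm_num [e, hx, hy]) e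
  cases P with
  | speak i msg next => simpa [Protocol.bits] using hP x
  | output b =>
    simp only [Fintype.sum_bool, e, cond, Protocol.eval] at hT
    rcases Int.units_eq_one_or (f x) with hx | hx <;>
    rcases Int.units_eq_one_or (f y) with hy | hy <;>
    · rw [hx, hy] at hT
      first
      | exact hxy (hx.trans hy.symm)
      | push_cast at hT
        linarith

/-! ### The discrepancy of the selection function -/

/-- Since `ψ` sums to zero (no bits prescribed), the correlation of `-ψ` with NOR is twice the value
of `ψ` at the zero string. -/
theorem exists_dual_NOR {A d : ℕ} (hA : 4 ≤ A) (hd : 1 ≤ d) :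
    ∃ ψ : (Fin (A * d ^ 2) → Bool) → ℝ, JuntaOrthogonal d ψ ∧ ∑ z, |ψ z| ≤ 1 ∧
      1 - 8 / A ≤ ∑ z, ψ z * if ∃ j, z j = true then 1 else -1 := by
  obtain ⟨ψ, h1, h2, h3⟩ := exists_dual_OR hA hd
  refine ⟨fun z => -ψ z, fun B a hB => ?_, by simpa only [abs_neg] using h2, h3.trans (le_of_eq ?_)⟩
  · rw [Finset.sum_neg_distrib, h1 B a hB, neg_zero]
  · have h0 := h1 ∅ (fun _ => false) (by simp)
    simp only [Finset.notMem_empty, false_imp_iff, implies_true, Finset.filter_true] at h0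
    have hz : ∀ z : Fin (A * d ^ 2) → Bool, (-ψ z * if ∃ j, z j = true then 1 else -1) =
        -ψ z + 2 * if z = fun _ => false then ψ z else 0 := fun z => by
      by_cases h : ∃ j, z j = true
      · have : z ≠ fun _ => false := by
          rintro rfl
          simp at h
        rw [if_pos h, if_neg this]
        ring
      · have : z = fun _ => false := by
          funext j
          simpa using fun hj => h ⟨j, hj⟩
        rw [if_neg h, if_pos this]
        ring
    simp only [hz]
    rw [Finset.sum_add_distrib, Finset.sum_neg_distrib, h0, ← Finset.mul_sum, Finset.sum_ite_eq',
      if_pos (Finset.mem_univ _)]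
    ring

variable {K m l n : ℕ}

/-- Selection as an instance of Disjointness: the `i`-th set marks the positions whose `i`-th
coordinate is the chosen one. -/
noncomputable def gadget (σ : Fin m × (Fin K → Fin l) ↪ Fin n)
    (x : Fin m × (Fin K → Fin l) → Bool) (S : Fin K → Fin m → Fin l) :
    Fin (K + 1) → Fin n → Bool :=
  Fin.cons (Function.extend σ x fun _ => false) fun i =>
    Function.extend σ (fun p => decide (p.2 i = S i p.1)) fun _ => false

theorem DISJ_gadget (σ : Fin m × (Fin K → Fin l) ↪ Fin n)
    (x : Fin m × (Fin K → Fin l) → Bool) (S : Fin K → Fin m → Fin l) :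
    DISJ (K + 1) n (gadget σ x S) = if ∃ j, select x S j = true then 1 else -1 := by
  classical
  rw [DISJ_eq]
  refine if_congr ?_ rfl rfl
  simp only [Fin.forall_fin_succ, gadget, Fin.cons_zero, Fin.cons_succ]
  constructor
  · rintro ⟨c, h0, hi⟩
    by_cases hc : ∃ p, σ p = c
    · obtain ⟨p, rfl⟩ := hc
      rw [σ.injective.extend_apply] at h0
      refine ⟨p.1, ?_⟩
      have hp : p = (p.1, fun i => S i p.1) := by
        refine Prod.ext rfl (funext fun i => ?_)
        have := hi i
        rw [σ.injective.extend_apply] at this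
        simpa using this
      simp only [select]
      rw [← hp]
      exact h0
    · rw [Function.extend_apply' _ _ _ hc] at h0
      cases h0
  · rintro ⟨j, hj⟩
    refine ⟨σ (j, fun i => S i j), ?_, fun i => ?_⟩
    · rw [σ.injective.extend_apply]
      exact hj
    · rw [σ.injective.extend_apply]
      simp

theorem gadget_update (σ : Fin m × (Fin K → Fin l) ↪ Fin n)
    (x : Fin m × (Fin K → Fin l) → Bool) (S : Fin K → Fin m → Fin l) (i : Fin K)
    (y : Fin m → Fin l) :
    gadget σ x (Function.update S i y) = Function.update (gadget σ x S) i.succ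
      (Function.extend σ (fun p => decide (p.2 i = y p.1)) fun _ => false) := by
  rw [gadget, gadget, ← Fin.cons_update]
  congr 1
  funext i'
  by_cases h : i' = i
  · subst h
    simp
  · rw [Function.update_of_ne h, Function.update_of_ne h]

theorem gadget_zero (σ : Fin m × (Fin K → Fin l) ↪ Fin n)
    (x x' : Fin m × (Fin K → Fin l) → Bool) (S : Fin K → Fin m → Fin l) :
    gadget σ x S = Function.update (gadget σ x' S) 0 (Function.extend σ x fun _ => false) := by
  rw [gadget, gadget, Fin.update_cons_zero (α := fun _ => Fin n → Bool)]

theorem abs_expect_cylinder_pow_le {d : ℕ} {ψ : (Fin m → Bool) → ℝ} (h1 : JuntaOrthogonal d ψ)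
    (h2 : ∑ z, |ψ z| ≤ 1) (hl : 0 < l) (hml : 6 * 2 ^ 2 ^ K * K * m ≤ d * l)
    (σ : Fin m × (Fin K → Fin l) ↪ Fin n) {φ : (Fin (K + 1) → Fin n → Bool) → ℝ}
    (hφ : IsCylinder φ) :
    |𝔼 x, 𝔼 S, 2 ^ m * ψ (select x S) * φ (gadget σ x S)| ^ 2 ^ K ≤ (1 / 2) ^ d := by
  have : Nonempty (Fin l) := ⟨⟨0, hl⟩⟩
  obtain ⟨F, hF1, hF2, hF3⟩ := hφ
  have hbox := abs_expect_mul_cylinder_pow_le K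
    (fun (x : Fin m × (Fin K → Fin l) → Bool) S => 2 ^ m * ψ (select x S))
    (fun S => F 0 (gadget σ (fun _ => false) S)) (fun i x S => F i.succ (gadget σ x S))
    (fun S => hF1 _ _) (fun i x S => hF1 _ _)
    (fun i x S y => by rw [gadget_update, hF2])
  -- The factor of player 0 ignores `x`, so it can be evaluated at a fixed `x`; it plays the role of
  -- `φ₀`.
  have hφF : ∀ x S, φ (gadget σ x S) = F 0 (gadget σ (fun _ => false) S) *
      ∏ i : Fin K, F i.succ (gadget σ x S) := fun x S => by
    rw [hF3, Fin.prod_univ_succ, gadget_zero σ x (fun _ => false) S, hF2, ← gadget_zero]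
  simp only [← hφF] at hbox
  refine hbox.trans ?_
  -- The factor `6 ^ (b - d)`, with `b` bad blocks, is at least 1 when `b > d`. It turns the cutoff
  -- into an exponential moment; 6 is chosen so that `exp 1 / 6 ≤ 1 / 2`.
  have hS : ∀ S : Fin K → Bool → Fin m → Fin l,
      |𝔼 x : Fin m × (Fin K → Fin l) → Bool,
        ∏ u : Fin K → Bool, 2 ^ m * ψ (select x fun i => S i (u i))| ≤
      (1 / 6) ^ d * (6 * 2 ^ 2 ^ K) ^ (badBlocks S).card := fun S => by
    have e1 : 𝔼 x : Fin m × (Fin K → Fin l) → Bool,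
        ∏ u : Fin K → Bool, 2 ^ m * ψ (select x fun i => S i (u i)) =
        (𝔼 x : Fin m × (Fin K → Fin l) → Bool,
          ∏ u : Fin K → Bool, ψ (select x fun i => S i (u i))) * (2 ^ 2 ^ K) ^ m := by
      rw [Finset.expect_mul]
      refine Finset.expect_congr rfl fun x _ => ?_
      rw [Finset.prod_mul_distrib, Finset.prod_const, Finset.card_univ, Fintype.card_fun,
        Fintype.card_bool, Fintype.card_fin, ← pow_mul, ← pow_mul, mul_comm m, mul_comm]
    rw [e1]
    by_cases hd : (badBlocks S).card ≤ d
    · rw [expect_prod_select_eq_zero h1 S hd, zero_mul, abs_zero]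
      positivity
    · rw [abs_mul, abs_of_nonneg (by positivity : (0 : ℝ) ≤ (2 ^ 2 ^ K) ^ m)]
      refine (abs_expect_prod_select_le h2 S).trans ?_
      rw [mul_pow, ← mul_assoc]
      refine le_mul_of_one_le_left (by positivity) ?_
      rw [one_div, inv_pow, ← div_eq_inv_mul, one_le_div (by positivity)]
      exact pow_le_pow_right₀ (by norm_num) (by omega)
  have hq : (1 : ℝ) ≤ 6 * 2 ^ 2 ^ K := by
    have : (1 : ℝ) ≤ 2 ^ 2 ^ K := one_le_pow₀ one_le_two
    linarith
  calc _ ≤ 𝔼 S : Fin K → Bool → Fin m → Fin l,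
        (1 / 6 : ℝ) ^ d * (6 * 2 ^ 2 ^ K) ^ (badBlocks S).card :=
        Finset.expect_le_expect fun S _ => hS S
    _ ≤ (1 / 6 : ℝ) ^ d * Real.exp (K * m * (6 * 2 ^ 2 ^ K / l)) := by
        rw [← Finset.mul_expect]
        gcongr
        exact expect_pow_badBlocks_le hl hq
    _ ≤ (1 / 6 : ℝ) ^ d * Real.exp d := by
        gcongr
        have hl' : (0 : ℝ) < l := by exact_mod_cast hl
        rw [← mul_div_assoc, div_le_iff₀ hl']
        have : (6 * 2 ^ 2 ^ K * K * m : ℝ) ≤ d * l := by exact_mod_cast hml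
        linarith
    _ = (Real.exp 1 / 6) ^ d := by
        rw [← mul_one (d : ℝ), Real.exp_nat_mul, ← mul_pow]
        ring
    _ ≤ _ := by
        refine pow_le_pow_left₀ (by positivity) ?_ d
        linarith [Real.exp_one_lt_d9]

/-- The selected string is uniform for each fixed `S`, so the lifted weight keeps the ℓ¹-norm and
the correlation of `ψ`. -/
theorem expect_select_mul (hl : 0 < l) (g : (Fin m → Bool) → ℝ) :
    𝔼 x : Fin m × (Fin K → Fin l) → Bool, 𝔼 S, 2 ^ m * g (select x S) = ∑ z, g z := by
  have : Nonempty (Fin l) := ⟨⟨0, hl⟩⟩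
  rw [Finset.expect_comm]
  have h : ∀ S : Fin K → Fin m → Fin l,
      𝔼 x : Fin m × (Fin K → Fin l) → Bool, 2 ^ m * g (select x S) = ∑ z, g z := fun S => by
    rw [← Finset.mul_expect, expect_select, Fintype.expect_eq_sum_div_card]
    simp
    field_simp
  simp only [h]
  exact Finset.expect_const Finset.univ_nonempty _

/-- The lower bound for Disjointness in terms of the degree of the dual polynomial. -/
theorem RandomizedWithin.degree_le {ε : ℝ} {A d L c : ℕ} (hA : 4 ≤ A) (hAε : 8 / A ≤ ε)
    (hL : (1 / 2 : ℝ) ^ L ≤ ε) (hd : 1 ≤ d) (hK : 1 ≤ K)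
    (hn : A * d ^ 2 * (6 * 2 ^ 2 ^ K * K * A * d) ^ K ≤ n)
    (h : RandomizedWithin ε (DISJ (K + 1) n) c) : d ≤ (c + L) * 2 ^ K := by
  have hdual := exists_dual_NOR hA hd
  obtain ⟨m, hm⟩ : ∃ m, A * d ^ 2 = m := ⟨_, rfl⟩
  rw [hm] at hdual hn
  obtain ⟨ψ, h1, h2, h3⟩ := hdual
  set l := 6 * 2 ^ 2 ^ K * K * A * d with hl_def
  have hl : 0 < l := by positivity
  have : Nonempty (Fin l) := ⟨⟨0, hl⟩⟩
  have hml : 6 * 2 ^ 2 ^ K * K * m ≤ d * l := le_of_eq (by rw [← hm, hl_def]; ring)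
  obtain ⟨σ⟩ : Nonempty (Fin m × (Fin K → Fin l) ↪ Fin n) := by
    rw [Function.Embedding.nonempty_iff_card_le]
    simpa using hn
  let W := (Fin m × (Fin K → Fin l) → Bool) × (Fin K → Fin m → Fin l)
  let Ψ : W → ℝ := fun w => 2 ^ m * ψ (select w.1 w.2) / Fintype.card W
  let e : W → Fin (K + 1) → Fin n → Bool := fun w => gadget σ w.1 w.2
  have hsum : ∀ g : W → ℝ, ∑ w, Ψ w * g w =
      𝔼 x, 𝔼 S, 2 ^ m * ψ (select x S) * g (x, S) := fun g => by
    rw [← expect_prod_type fun w : W => 2 ^ m * ψ (select w.1 w.2) * g w,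
      Fintype.expect_eq_sum_div_card, Finset.sum_div]
    exact Finset.sum_congr rfl fun w _ => by simp only [Ψ]; ring
  have hΨ : ∑ w, |Ψ w| ≤ 1 := by
    rw [← expect_select_mul (K := K) hl fun z => |ψ z|,
      ← expect_prod_type fun w : W => 2 ^ m * |ψ (select w.1 w.2)|,
      Fintype.expect_eq_sum_div_card, Finset.sum_div] at h2
    refine le_trans (le_of_eq ?_) h2
    refine Finset.sum_congr rfl fun w _ => ?_
    simp only [Ψ]
    rw [abs_div, abs_mul, abs_of_nonneg (by positivity : (0 : ℝ) ≤ 2 ^ m),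
      abs_of_nonneg (Nat.cast_nonneg (α := ℝ) (Fintype.card W))]
  obtain ⟨P, hP, hT⟩ := h.exists_protocol Ψ hΨ e
  have hcorr : 1 - 8 / A ≤ ∑ w, Ψ w * ((DISJ (K + 1) n (e w) : ℤ) : ℝ) := by
    refine h3.trans (le_of_eq ?_)
    rw [hsum, ← expect_select_mul (K := K) hl]
    refine Finset.expect_congr rfl fun x _ => Finset.expect_congr rfl fun S _ => ?_
    simp only [e]
    rw [DISJ_gadget, ← mul_assoc]
    split_ifs <;> simp
  let D : ℝ := ((1 / 2) ^ d) ^ (((2 ^ K : ℕ) : ℝ)⁻¹)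
  have hD : D ^ 2 ^ K = (1 / 2) ^ d := Real.rpow_inv_natCast_pow (by positivity) (by positivity)
  have hD0 : 0 ≤ D := Real.rpow_nonneg (by positivity) _
  have hcyl : ∀ φ, IsCylinder φ → |∑ w, Ψ w * φ (e w)| ≤ D := fun φ hφ => by
    rw [hsum fun w => φ (e w)]
    refine le_of_pow_le_pow_left₀ (n := 2 ^ K) (by positivity) hD0 ?_
    rw [hD]
    exact abs_expect_cylinder_pow_le h1 h2 hl hml σ hφ
  have hprot := P.abs_sum_mul_eval_le Ψ e hcyl c _ isCylinder_one fun z _ => hP z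
  simp only [one_mul] at hprot
  -- The correlation left is at least `(1 - 8 / A) - (1 - 2 * ε) ≥ ε`.
  have hεD : (1 / 2 : ℝ) ^ L ≤ 2 ^ c * D := by
    linarith [le_abs_self (∑ w, Ψ w * ((P.eval (e w) : ℤ) : ℝ))]
  have hpow := pow_le_pow_left₀ (by positivity) hεD (2 ^ K)
  rw [mul_pow, hD, ← pow_mul, ← pow_mul, one_div, inv_pow, inv_pow, ← div_eq_mul_inv,
    le_div_iff₀ (by positivity), inv_mul_le_iff₀ (by positivity), ← pow_add] at hpow
  have := (pow_le_pow_iff_right₀ (one_lt_two (α := ℝ))).mp hpow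
  linarith

end NOF

namespace NOF

/-! ### The lower bound for Disjointness -/

theorem exists_DISJ_ne (k : ℕ) [NeZero k] {n : ℕ} (hn : 1 ≤ n) :
    ∃ x y, DISJ k n x ≠ DISJ k n y := by
  refine ⟨fun _ _ => true, fun _ _ => false, ?_⟩
  rw [DISJ_eq, DISJ_eq, if_pos ⟨⟨0, hn⟩, fun _ => rfl⟩, if_neg (by simp)]
  decide

theorem exists_DISJ_lower_bound {ε : ℝ} (hε : 0 < ε) :
    ∃ c : ℝ, 0 < c ∧ ∀ (k : ℕ) [NeZero k], 2 ≤ k → ∀ n : ℕ,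
      ENNReal.ofReal (c * ((n : ℝ) ^ (1 / ((k : ℝ) + 1)) /
        (2 ^ (2 ^ k) * ((k : ℝ) - 1) * 2 ^ (k - 1)))) ≤ (R ε (DISJ k n) : ℝ≥0∞) := by
  obtain ⟨A, hA⟩ := exists_nat_ge (max 4 (8 / ε))
  have hA4 : 4 ≤ A := by exact_mod_cast (le_max_left _ _).trans hA
  have hA0 : (0 : ℝ) < A := by exact_mod_cast (by omega : 0 < A)
  have hAε : 8 / (A : ℝ) ≤ ε := by
    rw [div_le_iff₀ hA0]
    have := (div_le_iff₀ hε).mp ((le_max_right _ _).trans hA)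
    linarith
  obtain ⟨L, hL⟩ := exists_pow_lt_of_lt_one hε (by norm_num : (1 / 2 : ℝ) < 1)
  refine ⟨1 / (12 * A * (1 + L)), by positivity, fun k _ hk n => ?_⟩
  obtain ⟨K, rfl⟩ : ∃ K, k = K + 1 := ⟨k - 1, by omega⟩
  have hK : 1 ≤ K := by omega
  have hK0 : (0 : ℝ) < K := by exact_mod_cast hK
  rw [le_R_iff]
  intro C hC
  rcases Nat.eq_zero_or_pos n with rfl | hn
  · rw [Nat.cast_zero, Real.zero_rpow (by positivity)]
    simp
  obtain ⟨x, y, hxy⟩ := exists_DISJ_ne (K + 1) hn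
  -- This absorbs the additive `L` into a factor `1 + L` and settles small `n`, where `d` is zero.
  have hC1 : (1 : ℝ) ≤ C := by exact_mod_cast hC.pos_of_ne hε hxy
  set t : ℝ := (n : ℝ) ^ (1 / (((K + 1 : ℕ) : ℝ) + 1)) with ht
  have ht0 : 0 ≤ t := by positivity
  have htn : t ^ (K + 2) = n := by
    rw [ht, ← Real.rpow_natCast, ← Real.rpow_mul (Nat.cast_nonneg n)]
    have : 1 / (((K + 1 : ℕ) : ℝ) + 1) * ((K + 2 : ℕ) : ℝ) = 1 := by
      push_cast
      field_simp
      ring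
    rw [this, Real.rpow_one]
  obtain ⟨B, hB⟩ : ∃ B : ℕ, B = 6 * 2 ^ 2 ^ K * K * A := ⟨_, rfl⟩
  have hB1 : 1 ≤ B := by
    rw [hB]
    exact Nat.one_le_iff_ne_zero.mpr (by positivity)
  have hB0 : (0 : ℝ) < B := by exact_mod_cast hB1
  have hAB : A ≤ B ^ 2 := by
    have h1 : A ≤ B := by
      rw [hB]
      exact Nat.le_mul_of_pos_left A (by positivity)
    exact h1.trans (Nat.le_self_pow (by norm_num) B)
  -- The largest `d` with `(B * d) ^ (K + 2) ≤ n`; since `A ≤ B ^ 2`, the `m * l ^ K` positions then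
  -- fit into `n`.
  set d := ⌊t / B⌋₊ with hd
  have hdt : B * (d : ℝ) ≤ t := by
    have := Nat.floor_le (div_nonneg ht0 hB0.le)
    rw [← hd, le_div_iff₀ hB0] at this
    linarith
  have htd : t ≤ B * (d + 1) := by
    have := (Nat.lt_floor_add_one (t / B)).le
    rw [← hd, div_le_iff₀ hB0] at this
    linarith
  have hkey : (d : ℝ) + 1 ≤ 2 * ((1 + L) * C) * 2 ^ K := by
    have h2K : (1 : ℝ) ≤ 2 ^ K := one_le_pow₀ one_le_two
    have hLC : (C : ℝ) + L ≤ (1 + L) * C := by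
      nlinarith [Nat.cast_nonneg (α := ℝ) L]
    rcases Nat.eq_zero_or_pos d with h0 | hd1
    · rw [h0, Nat.cast_zero]
      nlinarith [Nat.cast_nonneg (α := ℝ) L]
    · have hdeg := hC.degree_le hA4 hAε hL.le hd1 hK (by
        have h1 : ((B * d : ℕ) : ℝ) ^ (K + 2) ≤ n := by
          rw [← htn]
          push_cast
          exact pow_le_pow_left₀ (by positivity) hdt _
        have h2 : (B * d) ^ (K + 2) ≤ n := by exact_mod_cast h1
        refine le_trans ?_ h2
        rw [← hB]
        calc A * d ^ 2 * (B * d) ^ K ≤ B ^ 2 * d ^ 2 * (B * d) ^ K := by gcongr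
          _ = (B * d) ^ (K + 2) := by ring)
      have hdeg' : (d : ℝ) ≤ (C + L) * 2 ^ K := by exact_mod_cast hdeg
      have hd1' : (1 : ℝ) ≤ d := by exact_mod_cast hd1
      nlinarith
  have hBr : (B : ℝ) = 6 * 2 ^ 2 ^ K * K * A := by
    rw [hB]
    push_cast
    rfl
  have hpow : (2 : ℝ) ^ 2 ^ K ≤ 2 ^ 2 ^ (K + 1) :=
    pow_le_pow_right₀ one_le_two (Nat.pow_le_pow_right two_pos (Nat.le_succ K))
  rw [Nat.add_sub_cancel, show ((K + 1 : ℕ) : ℝ) - 1 = K by push_cast; ring, one_div_mul_eq_div,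
    div_div, div_le_iff₀ (by positivity)]
  calc t ≤ B * (2 * ((1 + L) * C) * 2 ^ K) := htd.trans (by gcongr)
    _ = 2 ^ 2 ^ K * (12 * K * A * (1 + L) * C * 2 ^ K) := by rw [hBr]; ring
    _ ≤ 2 ^ 2 ^ (K + 1) * (12 * K * A * (1 + L) * C * 2 ^ K) := by gcongr
    _ = _ := by ring

theorem DISJ_eventually_ge_rpow {ε : ℝ} (hε : 0 < ε) (k : ℕ) [NeZero k] (hk : 2 ≤ k) :
    ∃ α : ℝ, 0 < α ∧ ∀ᶠ n : ℕ in atTop,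
      ENNReal.ofReal ((n : ℝ) ^ α) ≤ (R ε (DISJ k n) : ℝ≥0∞) := by
  obtain ⟨c, hc, hR⟩ := exists_DISJ_lower_bound hε
  set M : ℝ := 2 ^ (2 ^ k) * ((k : ℝ) - 1) * 2 ^ (k - 1) with hM
  have hk1 : (0 : ℝ) < (k : ℝ) - 1 := by
    have : (2 : ℝ) ≤ k := by exact_mod_cast hk
    linarith
  have hM0 : 0 < M := by positivity
  have hα : 0 < 1 / (2 * ((k : ℝ) + 1)) := by positivity
  -- Half of the exponent is given up to beat the constant `M / c`.
  refine ⟨1 / (2 * ((k : ℝ) + 1)), hα, ?_⟩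
  have htend := (tendsto_rpow_atTop hα).comp tendsto_natCast_atTop_atTop
  filter_upwards [htend.eventually_ge_atTop (M / c)] with n hn
  refine le_trans (ENNReal.ofReal_le_ofReal ?_) (hR k hk n)
  simp only [Function.comp_apply] at hn
  have hsq : (n : ℝ) ^ (1 / ((k : ℝ) + 1)) =
      (n : ℝ) ^ (1 / (2 * ((k : ℝ) + 1))) * (n : ℝ) ^ (1 / (2 * ((k : ℝ) + 1))) := by
    rw [← Real.rpow_add_of_nonneg (Nat.cast_nonneg n) hα.le hα.le]
    congr 1
    field_simp
    norm_num
  rw [hsq, ← mul_div_assoc, le_div_iff₀ hM0]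
  rw [div_le_iff₀ hc] at hn
  have h0 : 0 ≤ (n : ℝ) ^ (1 / (2 * ((k : ℝ) + 1))) := by positivity
  nlinarith

/-! ### The separation of the two classes -/

theorem OR_mem_NPcc (k : ℕ → ℕ) [∀ n, NeZero (k n)] (hk : ∀ n, 2 ≤ k n) :
    (fun n => G (k n) (OR n)) ∈ NPcc k := by
  refine ⟨5, 1, ?_⟩
  filter_upwards [eventually_ge_atTop 3] with n hn
  have h1 : (N (G (k n) (OR n)) : ℝ≥0∞) ≤ (((Nat.clog 2 n + 2 : ℕ) : ℕ∞) : ℝ≥0∞) := by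
    exact_mod_cast N_OR_le (k n) (hk n) n
  refine h1.trans ?_
  rw [ENat.toENNReal_coe, ← ENNReal.ofReal_natCast]
  refine ENNReal.ofReal_le_ofReal ?_
  have hn3 : (3 : ℝ) ≤ n := by exact_mod_cast hn
  have hlog : 1 ≤ Real.log n := by
    rw [Real.le_log_iff_exp_le (by linarith)]
    linarith [Real.exp_one_lt_d9]
  have hlt : 2 ^ (Nat.clog 2 n - 1) < n := Nat.pow_pred_clog_lt_self one_lt_two (by omega)
  have hpos : 1 ≤ Nat.clog 2 n := Nat.clog_pos one_lt_two (by omega)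
  have h2 : ((Nat.clog 2 n - 1 : ℕ) : ℝ) * Real.log 2 ≤ Real.log n := by
    rw [← Real.log_pow]
    refine Real.log_le_log (by positivity) ?_
    exact_mod_cast hlt.le
  rw [Nat.cast_sub hpos] at h2
  push_cast at h2 ⊢
  have hlog2 := Real.log_two_gt_d9
  have h3 : (1 : ℝ) ≤ Nat.clog 2 n := by exact_mod_cast hpos
  nlinarith

/-- For `k` at most half of `log log n`, the lower bound for Disjointness is exponential in
`√(log n)`. -/
theorem exp_sqrt_log_le {n k : ℕ} {s : ℝ} (hs : 0 < s) (hn : Real.log n = s ^ 2) (hk : 2 ≤ k)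
    (hks : (k : ℝ) ≤ Real.log s) (hk4 : 4 * ((k : ℝ) + 1) ≤ s) (hn0 : 0 < n) :
    Real.exp s ≤ (n : ℝ) ^ (1 / ((k : ℝ) + 1)) /
      (2 ^ (2 ^ k) * ((k : ℝ) - 1) * 2 ^ (k - 1)) := by
  have hk2 : (2 : ℝ) ≤ k := by exact_mod_cast hk
  have h2k : (2 : ℝ) ^ k ≤ s := by
    calc (2 : ℝ) ^ k ≤ Real.exp 1 ^ k :=
          pow_le_pow_left₀ zero_le_two (by linarith [Real.add_one_le_exp 1]) k
      _ = Real.exp k := by rw [← Real.exp_nat_mul, mul_one]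
      _ ≤ Real.exp (Real.log s) := Real.exp_le_exp.mpr hks
      _ = s := Real.exp_log hs
  have hse : s ≤ Real.exp s := by linarith [Real.add_one_le_exp s]
  have h22k : (2 : ℝ) ^ 2 ^ k ≤ Real.exp s := by
    calc (2 : ℝ) ^ 2 ^ k ≤ Real.exp 1 ^ 2 ^ k :=
          pow_le_pow_left₀ zero_le_two (by linarith [Real.add_one_le_exp 1]) _
      _ = Real.exp (2 ^ k) := by
          rw [← Real.exp_nat_mul, mul_one]
          push_cast
          rfl
      _ ≤ Real.exp s := Real.exp_le_exp.mpr h2k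
  have hk1 : (k : ℝ) - 1 ≤ Real.exp s := by linarith
  have h2k1 : (2 : ℝ) ^ (k - 1) ≤ Real.exp s :=
    (pow_le_pow_right₀ one_le_two (Nat.sub_le k 1)).trans (h2k.trans hse)
  have hk10 : (0 : ℝ) < (k : ℝ) - 1 := by linarith
  have hn0' : (0 : ℝ) < n := by exact_mod_cast hn0
  rw [le_div_iff₀ (by positivity), Real.rpow_def_of_pos hn0', hn]
  -- Each of the three factors of the denominator is at most `exp s`, while `n ^ (1 / (k + 1)) = exp
  -- (s² / (k + 1)) ≥ exp (4 * s)`.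
  calc Real.exp s * (2 ^ 2 ^ k * ((k : ℝ) - 1) * 2 ^ (k - 1))
      ≤ Real.exp s * (Real.exp s * Real.exp s * Real.exp s) := by gcongr
    _ = Real.exp (4 * s) := by
        rw [← Real.exp_add, ← Real.exp_add, ← Real.exp_add]
        ring_nf
    _ ≤ _ := by
        refine Real.exp_le_exp.mpr ?_
        rw [mul_one_div, le_div_iff₀ (by positivity)]
        nlinarith

theorem OR_notMem_BPPcc (k : ℕ → ℕ) [∀ n, NeZero (k n)] (hk : ∀ n, 2 ≤ k n)
    (hko : (fun n : ℕ => (k n : ℝ)) =o[atTop] (fun n : ℕ => Real.log (Real.log n))) :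
    (fun n => G (k n) (OR n)) ∉ BPPcc k := by
  rintro ⟨a, C, hC⟩
  obtain ⟨c, hc, hR⟩ := exists_DISJ_lower_bound (ε := 1 / 3) (by norm_num)
  have hs : Tendsto (fun n : ℕ => √(Real.log n)) atTop atTop :=
    Real.tendsto_sqrt_atTop.comp (Real.tendsto_log_atTop.comp tendsto_natCast_atTop_atTop)
  have hlog_small : ∀ᶠ s : ℝ in atTop, 8 * Real.log s ≤ s := by
    have := Real.isLittleO_log_id_atTop.bound (show (0 : ℝ) < 1 / 8 by norm_num)
    filter_upwards [this, eventually_ge_atTop 1] with s hs hs1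
    rw [Real.norm_of_nonneg (Real.log_nonneg hs1), id, Real.norm_of_nonneg (by linarith)] at hs
    linarith
  have hexp := (Real.tendsto_exp_div_pow_atTop (2 * C)).eventually_gt_atTop (a / c)
  have hko' := hko.bound (show (0 : ℝ) < 1 / 2 by norm_num)
  obtain ⟨n, hn, hsmall, hbig, hs1, hkn, hn1⟩ := (hC.and ((hs.eventually hlog_small).and
    ((hs.eventually hexp).and ((hs.eventually (eventually_ge_atTop 1)).and
      (hko'.and (eventually_ge_atTop 1)))))).exists
  set s := √(Real.log n) with hs_def
  have hs0 : 0 < s := by linarith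
  have hlog : Real.log n = s ^ 2 := by
    rw [hs_def, Real.sq_sqrt]
    exact Real.log_natCast_nonneg n
  have hk2 : (2 : ℝ) ≤ k n := by exact_mod_cast hk n
  have hks : (k n : ℝ) ≤ Real.log s := by
    rw [hlog, Real.log_pow, Real.norm_of_nonneg (Nat.cast_nonneg _), Real.norm_of_nonneg] at hkn
    · push_cast at hkn
      linarith
    · push_cast
      linarith [Real.log_nonneg hs1]
  -- `4 * (k + 1) ≤ 8 * k ≤ 8 * log s ≤ s`.
  have hlow := exp_sqrt_log_le hs0 hlog (hk n) hks (by linarith) hn1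
  have hle : ENNReal.ofReal (c * Real.exp s) ≤ ENNReal.ofReal (a * Real.log n ^ C) := by
    refine (ENNReal.ofReal_le_ofReal (mul_le_mul_of_nonneg_left hlow hc.le)).trans
      ((hR (k n) (hk n) n).trans (le_trans ?_ hn))
    have hneg : (fun z => -G (k n) (OR n) z) = DISJ (k n) n :=
      funext fun z => by rw [G_OR_eq_neg_DISJ, neg_neg]
    rw [← hneg]
    exact_mod_cast R_neg_le (1 / 3) (G (k n) (OR n))
  have hpos : 0 < c * Real.exp s := by positivity
  -- In terms of `s` the polylogarithmic bound reads `c * exp s ≤ a * s ^ (2 * C)`, which fails for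
  -- the chosen large `s`.
  rcases ENNReal.ofReal_le_ofReal_iff'.mp hle with h | h
  · rw [div_lt_div_iff₀ hc (by positivity)] at hbig
    rw [hlog, ← pow_mul] at h
    linarith
  · linarith

end NOF

theorem mainTheorem3 :
    -- the lower bound, with a constant that depends on `ε` only
    (∀ ε : ℝ, 0 < ε → ∃ c : ℝ, 0 < c ∧ ∀ (k : ℕ) [NeZero k], 2 ≤ k → ∀ n : ℕ,
      ENNReal.ofReal (c * ((n : ℝ) ^ (1 / ((k : ℝ) + 1)) /
        (2 ^ (2 ^ k) * ((k : ℝ) - 1) * 2 ^ (k - 1)))) ≤ (NOF.R ε (NOF.DISJ k n) : ℝ≥0∞)) ∧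
    -- for a constant number of players it is `n ^ Ω(1)`
    (∀ ε : ℝ, 0 < ε → ∀ (k : ℕ) [NeZero k], 2 ≤ k → ∃ α : ℝ, 0 < α ∧
      ∀ᶠ n : ℕ in atTop,
        ENNReal.ofReal ((n : ℝ) ^ α) ≤ (NOF.R ε (NOF.DISJ k n) : ℝ≥0∞)) ∧
    -- the complement of Disjointness separates the two classes for `k = o(log log n)`
    (∀ (k : ℕ → ℕ) [∀ n, NeZero (k n)], (∀ n, 2 ≤ k n) →
      (fun n : ℕ => (k n : ℝ)) =o[atTop] (fun n : ℕ => Real.log (Real.log n)) →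
      (fun n => NOF.G (k n) (NOF.OR n)) ∈ NOF.NPcc k ∧
      (fun n => NOF.G (k n) (NOF.OR n)) ∉ NOF.BPPcc k) :=
  ⟨fun _ hε => NOF.exists_DISJ_lower_bound hε,
    fun _ hε k _ hk => NOF.DISJ_eventually_ge_rpow hε k hk,
    fun k _ hk hko => ⟨NOF.OR_mem_NPcc k hk, NOF.OR_notMem_BPPcc k hk hko⟩⟩
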